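/- A directed graph $G=(V,E)$ with $V=\{0,\dots,n-1\}$ is given in the \emph{adjacency array model} if the out-degrees $d_u$ are known and the injective arrays $f_u:\{0,\dots,d_u-1\}\to V$ listing the out-neighbors of $u$ can be queried; it is given in the \emph{adjacency matrix model} if the entries of its adjacency matrix $M\in\{0,1\}^{n\times n}$ can be queried. A quantum query algorithm may make classical queries, and may run quantum circuits on finitely many registers (input-independent unitaries alternating with queries $|i,y,z\rangle\mapsto|i,y+x_i,z\rangle$ to the input $x$), measure the result, and continue depending on the outcome; its number of queries is the worst case over all branches. A directed tree rooted at $v_0$ is a set of directed edges such that no edge enters $v_0$, every vertex has at most one incoming edge, and all its vertices are reachable from $v_0$ within it; it spans $G$ if every vertex is reachable from $v_0$ within it. A \emph{depth-first search from $v_0$ with cutoff $B$} is the following algorithm. Start with $A=\emptyset$, $S=\{v_0\}$ and a stack holding $v_0$. While the stack is non-empty and at most $B$ queries have been made, run a quantum search subroutine for an out-neighbor of the vertex $u$ on top of the stack that is not in $S$, and check what it returns by one query; if this gives such a neighbor $v$, then add $(u,v)$ to $A$, add $v$ to $S$ and push $v$; otherwise remove $u$ from the stack. Finally output $A$. \textbf{Theorem.}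 There is a constant $C$ such that for all $n\ge 1$, all out-degrees $(d_u)_{u\in V}$ with $m=\sum_u d_u$, and every vertex $v_0$, there are a cutoff $B$ and search subroutines with the following properties in the adjacency array model. For $u\in S$, the subroutine for $u$ and $S$ makes at most $C\sqrt{d_u\log n}$ queries, and it finds an out-neighbor of $u$ outside $S$ with probability at least $1-\frac1{20n}$ if there is one. The depth-first search from $v_0$ with these subroutines and cutoff $B$ makes at most $C\sqrt{nm\log n}$ queries, and for every directed graph $G=(V,E)$ with these out-degrees 1. its output $A$ is, with probability $1$, a directed tree rooted at $v_0$ with $A\subseteq E$; 2. if $G$ has a directed spanning tree rooted at $v_0$, then with probability at least $\frac9{10}$ the tree $A$ spans all of $G$. The same holds in the adjacency matrix model, for all directed graphs $G$ on $V$, with $d_u$ replaced by $n$ in the bound for the subroutines and with $m$ replaced by $n(n-1)$, that is, with at most $C\sqrt{n\cdot n(n-1)\cdot\log n}=O(n^{3/2}\sqrt{\log n})$ queries to $M$. -/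

import Mathlib

/-! ## Quantum query model

The input is a function `x : I → Fin q`, accessible only through queries. -/

/-- Computational basis of a query circuit: a query-index register (`none` means that nothing
is queried), an answer register, and a work register of dimension `w`. -/
abbrev QBasis (I : Type) (q w : ℕ) : Type := Option I × Fin q × Fin w

/-- The query operator `|i, y, z⟩ ↦ |i, y + x i mod q, z⟩`, and `|none, y, z⟩ ↦ |none, y, z⟩`,
acting on amplitude vectors. -/
def queryOp {I : Type} {q w : ℕ} (x : I → Fin q) (ψ : QBasis I q w → ℂ) : QBasis I q w → ℂ
  | (none, y, z) => ψ (none, y, z)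
  | (some i, y, z) => ψ (some i, y - x i, z)

/-- A quantum circuit that starts in a fixed basis state and alternates the input-independent
unitaries `U 0, U 1, …, U T` with `T` queries. -/
structure QCircuit (I : Type) [Fintype I] [DecidableEq I] (q : ℕ) where
  w : ℕ
  T : ℕ
  U : ℕ → Matrix.unitaryGroup (QBasis I q w) ℂ
  start : QBasis I q w

namespace QCircuit

variable {I : Type} [Fintype I] [DecidableEq I] {q : ℕ}

/-- The state after `t` queries, `U t · O_x · U (t-1) · ⋯ · O_x · U 0 |start⟩`. -/
noncomputable def state (c : QCircuit I q) (x : I → Fin q) : ℕ → QBasis I q c.w → ℂ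
  | 0 => (c.U 0 : Matrix (QBasis I q c.w) (QBasis I q c.w) ℂ).mulVec (Pi.single c.start 1)
  | t + 1 => (c.U (t + 1) : Matrix (QBasis I q c.w) (QBasis I q c.w) ℂ).mulVec
      (queryOp x (c.state x t))

/-- Probability of the outcome `b` when the final state is measured in the computational basis. -/
noncomputable def outcomeProb (c : QCircuit I q) (x : I → Fin q) (b : QBasis I q c.w) : ℝ :=
  ‖c.state x c.T b‖ ^ 2

end QCircuit

/-- A quantum query algorithm with classical control: it stops with an output, makes one
classical query, or runs a quantum circuit, measures it, and continues depending on the outcome. -/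
inductive QProg (I : Type) [Fintype I] [DecidableEq I] (q : ℕ) (α : Type) : Type
  | ret (a : α) : QProg I q α
  | query (i : I) (k : Fin q → QProg I q α) : QProg I q α
  | run (c : QCircuit I q) (k : QBasis I q c.w → QProg I q α) : QProg I q α

namespace QProg

variable {I : Type} [Fintype I] [DecidableEq I] {q : ℕ} {α β : Type}

/-- Worst-case number of queries, over all computation branches. -/
def maxQueries : QProg I q α → ℕ
  | ret _ => 0
  | query _ k => 1 + Finset.univ.sup (fun y => (k y).maxQueries)
  | run c k => c.T + Finset.univ.sup (fun b => (k b).maxQueries)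

/-- Probability that the output on the input `x` lies in `E`. -/
noncomputable def prob (x : I → Fin q) (E : Set α) : QProg I q α → ℝ
  | ret a => E.indicator 1 a
  | query i k => (k (x i)).prob x E
  | run c k => ∑ b, c.outcomeProb x b * (k b).prob x E

/-- Sequential composition. -/
def bind (g : α → QProg I q β) : QProg I q α → QProg I q β
  | ret a => g a
  | query i k => query i (fun y => (k y).bind g)
  | run c k => run c (fun b => (k b).bind g)

/-- The same algorithm, returning with its output also `used` plus the number of queries that
were made on the branch taken. -/
def counted : ℕ → QProg I q α → QProg I q (α × ℕ)
  | used, ret a => ret (a, used)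
  | used, query i k => query i (fun y => (k y).counted (used + 1))
  | used, run c k => run c (fun b => (k b).counted (used + c.T))

end QProg

/-! ## Directed graphs, their two encodings, and directed trees -/

/-- The directed graph on `Fin n` given by out-neighbor arrays `f u : Fin (d u) → Fin n`. -/
def arrayGraph {n : ℕ} {d : Fin n → ℕ} (f : (u : Fin n) → Fin (d u) → Fin n) :
    Digraph (Fin n) where
  Adj u v := ∃ j, f u j = v

/-- The directed graph with adjacency matrix `M`. -/
def matrixGraph {n : ℕ} (M : Fin n → Fin n → Fin 2) : Digraph (Fin n) where
  Adj u v := M u v = 1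

/-- `v` can be reached from `u` along the directed edges in `A`. -/
def Reaches {n : ℕ} (A : Finset (Fin n × Fin n)) (u v : Fin n) : Prop :=
  Relation.ReflTransGen (fun a b => (a, b) ∈ A) u v

/-- `A` is the edge set of a directed tree rooted at `v₀` (whose vertices are `v₀` and the
endpoints of the edges): no edge enters the root, every vertex has at most one incoming edge,
and every vertex of the tree is reachable from the root. -/
structure IsDirectedTree {n : ℕ} (v₀ : Fin n) (A : Finset (Fin n × Fin n)) : Prop where
  root_no_in : ∀ u, (u, v₀) ∉ A
  in_unique : ∀ u u' v, (u, v) ∈ A → (u', v) ∈ A → u = u'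
  reachable : ∀ u v, (u, v) ∈ A → Reaches A v₀ u ∧ Reaches A v₀ v

/-- The edge sets of directed trees in `G` that are rooted at `v₀`. -/
def treesIn {n : ℕ} (G : Digraph (Fin n)) (v₀ : Fin n) : Set (Finset (Fin n × Fin n)) :=
  {A | (∀ e ∈ A, G.Adj e.1 e.2) ∧ IsDirectedTree v₀ A}

/-- The edge sets of directed trees in `G` that are rooted at `v₀` and contain every vertex. -/
def spanningTreesIn {n : ℕ} (G : Digraph (Fin n)) (v₀ : Fin n) :
    Set (Finset (Fin n × Fin n)) :=
  {A | A ∈ treesIn G v₀ ∧ ∀ v, Reaches A v₀ v}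

/-! ## Depth-first search with a quantum search subroutine

Both encodings consist of one row of `len u` entries for each vertex `u`; the entry number `j`
of row `u`, with value `y`, points to the neighbor `dec u j y` of `u` (to none if this is
`none`). -/

section DFS

variable {n q : ℕ} {len : Fin n → ℕ}

/-- Decoding of the entries in the array model: an entry is the neighbor itself. -/
def arrayDec {n : ℕ} (d : Fin n → ℕ) (u : Fin n) (_ : Fin (d u)) (y : Fin n) :
    Option (Fin n) := some y

/-- Decoding of the entries in the matrix model: entry `j` of row `u` points to `j` if it is 1. -/
def matrixDec {n : ℕ} (_ j : Fin n) (y : Fin 2) : Option (Fin n) :=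
  if y = 1 then some j else none

/-- A family of subroutines, one for each vertex `u` and each set `S` of visited vertices,
returning (the position in row `u` of) a neighbor of `u`, or `none`. -/
abbrev SearchFamily (n q : ℕ) (len : Fin n → ℕ) : Type :=
  (u : Fin n) → Finset (Fin n) → QProg ((u : Fin n) × Fin (len u)) q (Option (Fin (len u)))

/-- Position `j` of row `u` holds, for the input `x`, a neighbor of `u` that is not in `S`. -/
def IsNewNeighbor (dec : (u : Fin n) → Fin (len u) → Fin q → Option (Fin n))
    (x : (u : Fin n) × Fin (len u) → Fin q) (u : Fin n) (S : Finset (Fin n))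
    (j : Fin (len u)) : Prop :=
  ∃ v, dec u j (x ⟨u, j⟩) = some v ∧ v ∉ S

/-- For each visited vertex `u` the subroutine makes at most `C √(len u · log n)` queries and, on
each input in `X`, finds a neighbor of `u` outside `S` with probability at least `1 - 1/(20n)`
if there is one. -/
def IsNeighborSearch (dec : (u : Fin n) → Fin (len u) → Fin q → Option (Fin n))
    (X : Set ((u : Fin n) × Fin (len u) → Fin q)) (C : ℝ) (search : SearchFamily n q len) :
    Prop :=
  ∀ (u : Fin n) (S : Finset (Fin n)), u ∈ S →
    ((search u S).maxQueries : ℝ) ≤ C * Real.sqrt (len u * Real.log n) ∧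
    ∀ x ∈ X, (∃ j, IsNewNeighbor dec x u S j) →
      1 - 1 / (20 * (n : ℝ)) ≤
        (search u S).prob x {r | ∃ j, r = some j ∧ IsNewNeighbor dec x u S j}

/-- Search for a neighbor of `u` not in `S`, and check what was found with one more query. -/
def findNeighbor (dec : (u : Fin n) → Fin (len u) → Fin q → Option (Fin n))
    (search : SearchFamily n q len) (u : Fin n) (S : Finset (Fin n)) :
    QProg ((u : Fin n) × Fin (len u)) q (Option (Fin n)) :=
  (search u S).bind fun r =>
    match r with
    | none => QProg.ret none
    | some j => QProg.query ⟨u, j⟩ fun y =>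
        QProg.ret ((dec u j y).filter (fun v => v ∉ S))

/-- The main loop, with `A` the edges found so far, `S` the visited vertices, the stack, and the
number `used` of queries made so far. The loop ends when the stack is empty, or when
more than `B` queries have been made, or after `fuel` rounds. In each round the vertex on top of
the stack is searched for a new neighbor; such a neighbor is pushed onto the stack, and if none is
found, the vertex on top is removed. -/
def dfsLoop (dec : (u : Fin n) → Fin (len u) → Fin q → Option (Fin n))
    (search : SearchFamily n q len) (B : ℕ) :
    (fuel used : ℕ) → (A : Finset (Fin n × Fin n)) → (S : Finset (Fin n)) →
      (stack : List (Fin n)) →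
      QProg ((u : Fin n) × Fin (len u)) q (Finset (Fin n × Fin n))
  | 0, _, A, _, _ => QProg.ret A
  | _ + 1, _, A, _, [] => QProg.ret A
  | fuel + 1, used, A, S, u :: rest =>
      if B < used then QProg.ret A
      else ((findNeighbor dec search u S).counted used).bind fun r =>
        match r with
        | (none, used') => dfsLoop dec search B fuel used' A S rest
        | (some v, used') =>
            dfsLoop dec search B fuel used' (insert (u, v) A) (insert v S) (v :: u :: rest)

/-- Depth-first search from `v₀`. As each vertex is pushed and removed at most once, `2 * n`
rounds always suffice to empty the stack. -/
def dfs (dec : (u : Fin n) → Fin (len u) → Fin q → Option (Fin n))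
    (search : SearchFamily n q len) (B : ℕ) (v₀ : Fin n) :
    QProg ((u : Fin n) × Fin (len u)) q (Finset (Fin n × Fin n)) :=
  dfsLoop dec search B (2 * n) 0 ∅ {v₀} [v₀]

end DFS

/-! ## Expectations of quantum query programs -/

section QueryPrograms

open Finset

namespace QCircuit

/-! Each search consists of Grover runs, every one followed by a classical check, and its expected
cost adapts to the unknown number `t` of new neighbors. For a row of `N` entries let `l = min ⌈60
log n⌉ N`. The guesses for `t` descend a ladder: the values `l * 4 ^ i`, `l` times each, starting
between `N` and `4 N`, and then `l, …, 1` once each. A guess `g` costs about `√(N / g)`, so level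
`i` costs `O(√(N l) / 2 ^ i)` and the whole ladder `O(√(N l))`. The initial amplitudes are chosen
such that the guess `g = t` succeeds with certainty, which settles `t ≤ l`. If `t > l`, some guess
in `[t, 4 t]` succeeds with constant probability, and its `l` repetitions all fail with probability
at most `n ^ (-6)` (`failProb_guesses`).

Stopping at the first success lowers the expected cost to `O(√(N l / t))` (`expCost_guesses`): a
guess `g ≥ t` succeeds with probability at least `2 / 5 * (t / g)`, so the costs of the levels above
`t` have a dyadic sum that telescopes, and the levels below are reached with probability at most `10
/ √t`.

In the depth-first search, the search that ends the work at `u` costs `O(√(d u * log n))`, once per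
vertex. The successful searches at `u` occur at strictly decreasing values of `t`, so `k` children
cost at most `√(log n) * ∑ j ≤ k, √(d u / j)`, which is `O(√(d u * k * log n))`. There are fewer
than `n` discoveries in all, and Cauchy–Schwarz gives the expected total `O(√(n m log n))`. As the
number of children is random, this is carried out with a potential: the part `μ` of each successful
search is charged to the new vertex, and the rest to a reserve of at most `d u / μ` of the row; `μ =
√(m / n)` balances the two (`dfsPotential_push`, `dfsPotential_init_le`).

`prob_dfsLoop_spanningTreesIn` combines the estimates: by Markov's inequality the cutoff is reached
with probability at most `1 / 20`, and by a union bound over fewer than `n` discoveries some new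
neighbor is missed with probability at most `1 / 20`. That the output is a tree in the graph is an
invariant, since every edge is checked before it is added; the worst-case query count is the cutoff
plus the cost of one search. -/

theorem sum_norm_sq_mulVec {β : Type} [Fintype β] [DecidableEq β]
    (U : Matrix.unitaryGroup β ℂ) (ψ : β → ℂ) :
    ∑ b, ‖(U : Matrix β β ℂ).mulVec ψ b‖ ^ 2 = ∑ b, ‖ψ b‖ ^ 2 := by
  have key : ∀ φ : β → ℂ, ((∑ b, ‖φ b‖ ^ 2 : ℝ) : ℂ) = star φ ⬝ᵥ φ := by
    intro φ
    simp only [dotProduct, Pi.star_apply, Complex.ofReal_sum, Complex.ofReal_pow]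
    refine sum_congr rfl fun b _ => ?_
    rw [Complex.star_def, Complex.conj_mul']
  have h : star (U : Matrix β β ℂ) * (U : Matrix β β ℂ) = 1 := Matrix.mem_unitaryGroup_iff'.1 U.2
  apply Complex.ofReal_injective
  rw [key, key, Matrix.star_mulVec, ← Matrix.dotProduct_mulVec, Matrix.mulVec_mulVec,
    ← Matrix.star_eq_conjTranspose, h, Matrix.one_mulVec]

theorem sum_norm_sq_queryOp {I : Type} [Fintype I] {q : ℕ} [NeZero q] {w : ℕ} (x : I → Fin q) (ψ : QBasis I q w → ℂ) :
    ∑ b, ‖queryOp x ψ b‖ ^ 2 = ∑ b, ‖ψ b‖ ^ 2 := by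
  simp only [Fintype.sum_prod_type, Fintype.sum_option, queryOp]
  congr 1
  refine sum_congr rfl fun i _ => ?_
  exact Equiv.sum_comp (Equiv.subRight (x i)) fun y => ∑ z, ‖ψ (some i, y, z)‖ ^ 2

variable {I : Type} [Fintype I] [DecidableEq I] {q : ℕ}

theorem sum_norm_sq_state [NeZero q] (c : QCircuit I q) (x : I → Fin q) (t : ℕ) :
    ∑ b, ‖c.state x t b‖ ^ 2 = 1 := by
  induction t with
  | zero =>
    simp only [state]
    rw [sum_norm_sq_mulVec, sum_eq_single c.start]
    · simp
    · intro b _ hb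
      simp [hb]
    · simp
  | succ t ih =>
    simp only [state]
    rw [sum_norm_sq_mulVec, sum_norm_sq_queryOp, ih]

theorem outcomeProb_nonneg (c : QCircuit I q) (x : I → Fin q) (b : QBasis I q c.w) :
    0 ≤ c.outcomeProb x b := by
  unfold outcomeProb; positivity

theorem sum_outcomeProb [NeZero q] (c : QCircuit I q) (x : I → Fin q) :
    ∑ b, c.outcomeProb x b = 1 := c.sum_norm_sq_state x c.T

end QCircuit

namespace QProg

variable {I : Type} [Fintype I] [DecidableEq I] {q : ℕ} {α β : Type}

/-- Expectation, on the input `x`, of `h` applied to the output and to the number of queries made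
plus `c`. -/
noncomputable def expect (x : I → Fin q) (h : α → ℕ → ℝ) : ℕ → QProg I q α → ℝ
  | c, ret a => h a c
  | c, query i k => expect x h (c + 1) (k (x i))
  | c, run C k => ∑ b, C.outcomeProb x b * expect x h (c + C.T) (k b)

/-- Every output that the algorithm can produce on the input `x` satisfies `P`. -/
def Surely (x : I → Fin q) (P : α → Prop) : QProg I q α → Prop
  | ret a => P a
  | query i k => Surely x P (k (x i))
  | run _ k => ∀ b, Surely x P (k b)

theorem prob_eq_expect (x : I → Fin q) (E : Set α) (p : QProg I q α) (c : ℕ) :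
    p.prob x E = expect x (fun a _ => E.indicator 1 a) c p := by
  induction p generalizing c with
  | ret a => rfl
  | query i k ih => exact ih _ _
  | run C k ih =>
    simp only [prob, expect]
    exact sum_congr rfl fun b _ => by rw [ih b (c + C.T)]

theorem expect_bind (x : I → Fin q) (h : β → ℕ → ℝ) (g : α → QProg I q β) (p : QProg I q α)
    (c : ℕ) : expect x h c (p.bind g) = expect x (fun a c' => expect x h c' (g a)) c p := by
  induction p generalizing c with
  | ret a => rfl
  | query i k ih => exact ih _ _
  | run C k ih =>
    simp only [bind, expect]
    exact sum_congr rfl fun b _ => by rw [ih b (c + C.T)]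

/-- The counter returned by `counted` is exactly the second argument that `expect` passes to its
integrand, so the cutoff test of the loop can be analyzed inside an expectation. -/
theorem prob_counted_bind (x : I → Fin q) (E : Set β) (g : α × ℕ → QProg I q β)
    (p : QProg I q α) (c : ℕ) :
    ((p.counted c).bind g).prob x E = expect x (fun a c' => (g (a, c')).prob x E) c p := by
  induction p generalizing c with
  | ret a => rfl
  | query i k ih => exact ih _ _
  | run C k ih =>
    simp only [counted, bind, expect, prob]
    exact sum_congr rfl fun b _ => by rw [ih b (c + C.T)]

theorem surely_bind {x : I → Fin q} {P : α → Prop} {Q : β → Prop} {g : α → QProg I q β}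
    {p : QProg I q α} (hp : p.Surely x P) (hg : ∀ a, P a → (g a).Surely x Q) :
    (p.bind g).Surely x Q := by
  induction p with
  | ret a => exact hg a hp
  | query i k ih => exact ih _ hp
  | run C k ih => exact fun b => ih b (hp b)

theorem surely_true (x : I → Fin q) (p : QProg I q α) : p.Surely x fun _ => True := by
  induction p with
  | ret a => trivial
  | query i k ih => exact ih _
  | run C k ih => exact fun b => ih b

theorem expect_mono {x : I → Fin q} {P : α → Prop} {h h' : α → ℕ → ℝ} {p : QProg I q α}
    (hp : p.Surely x P) (H : ∀ a c, P a → h a c ≤ h' a c) (c : ℕ) :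
    expect x h c p ≤ expect x h' c p := by
  induction p generalizing c with
  | ret a => exact H a c hp
  | query i k ih => exact ih _ hp _
  | run C k ih =>
    exact sum_le_sum fun b _ =>
      mul_le_mul_of_nonneg_left (ih b (hp b) _) (C.outcomeProb_nonneg x b)

theorem expect_congr {x : I → Fin q} {P : α → Prop} {h h' : α → ℕ → ℝ} {p : QProg I q α}
    (hp : p.Surely x P) (H : ∀ a c, P a → h a c = h' a c) (c : ℕ) :
    expect x h c p = expect x h' c p :=
  le_antisymm (expect_mono hp (fun a c ha => (H a c ha).le) c)
    (expect_mono hp (fun a c ha => (H a c ha).ge) c)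

theorem expect_add (x : I → Fin q) (h h' : α → ℕ → ℝ) (p : QProg I q α) (c : ℕ) :
    expect x (fun a c => h a c + h' a c) c p = expect x h c p + expect x h' c p := by
  induction p generalizing c with
  | ret a => rfl
  | query i k ih => exact ih _ _
  | run C k ih => simp only [expect, ih, mul_add, sum_add_distrib]

theorem expect_const_mul (x : I → Fin q) (r : ℝ) (h : α → ℕ → ℝ) (p : QProg I q α) (c : ℕ) :
    expect x (fun a c => r * h a c) c p = r * expect x h c p := by
  induction p generalizing c with
  | ret a => rfl
  | query i k ih => exact ih _ _
  | run C k ih => simp only [expect, ih, mul_sum, mul_left_comm]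

theorem expect_const [NeZero q] (x : I → Fin q) (r : ℝ) (p : QProg I q α) (c : ℕ) :
    expect x (fun _ _ => r) c p = r := by
  induction p generalizing c with
  | ret a => rfl
  | query i k ih => exact ih _ _
  | run C k ih => simp only [expect, ih, ← sum_mul, C.sum_outcomeProb, one_mul]

/-- Expected number of queries on the input `x`. -/
noncomputable def expQueries (x : I → Fin q) (p : QProg I q α) : ℝ :=
  expect x (fun _ c => (c : ℝ)) 0 p

theorem expect_shift (x : I → Fin q) (h : α → ℕ → ℝ) (p : QProg I q α) (c d : ℕ) :
    expect x h (c + d) p = expect x (fun a e => h a (c + e)) d p := by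
  induction p generalizing d with
  | ret a => rfl
  | query i k ih => exact ih _ (d + 1)
  | run C k ih => simp only [expect, add_assoc, ih]

theorem expect_queries [NeZero q] (x : I → Fin q) (p : QProg I q α) (c : ℕ) :
    expect x (fun _ c => (c : ℝ)) c p = c + p.expQueries x := by
  have h := expect_shift x (fun _ c => (c : ℝ)) p c 0
  simp only [add_zero, Nat.cast_add] at h
  rw [h, expect_add x (fun _ _ => (c : ℝ)), expect_const]
  rfl

theorem expQueries_le_maxQueries [NeZero q] (x : I → Fin q) (p : QProg I q α) :
    p.expQueries x ≤ p.maxQueries := by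
  suffices H : ∀ c : ℕ, expect x (fun _ c => (c : ℝ)) c p ≤ c + p.maxQueries by
    simpa [expQueries] using H 0
  induction p with
  | ret a => intro c; simp [expect, maxQueries]
  | query i k ih =>
    intro c
    refine (ih (x i) (c + 1)).trans ?_
    have := le_sup (f := fun y => (k y).maxQueries) (mem_univ (x i))
    simp only [maxQueries]
    push_cast
    have : ((k (x i)).maxQueries : ℝ) ≤ (univ.sup fun y => (k y).maxQueries : ℕ) := by
      exact_mod_cast this
    linarith
  | run C k ih =>
    intro c
    have hb : ∀ b, expect x (fun _ c => (c : ℝ)) (c + C.T) (k b) ≤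
        c + ((run C k).maxQueries : ℝ) := by
      intro b
      refine (ih b (c + C.T)).trans ?_
      have := le_sup (f := fun b => (k b).maxQueries) (mem_univ b)
      have : ((k b).maxQueries : ℝ) ≤ (univ.sup fun y => (k y).maxQueries : ℕ) := by
        exact_mod_cast this
      simp only [maxQueries]
      push_cast
      linarith
    calc expect x (fun _ c => (c : ℝ)) c (run C k)
        ≤ ∑ b, C.outcomeProb x b * (c + ((run C k).maxQueries : ℝ)) :=
          sum_le_sum fun b _ => mul_le_mul_of_nonneg_left (hb b) (C.outcomeProb_nonneg x b)
      _ = _ := by rw [← sum_mul, C.sum_outcomeProb, one_mul]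

theorem add_maxQueries_counted_bind_le [NeZero q] {W : ℕ} (g : α × ℕ → QProg I q β)
    (p : QProg I q α) (c : ℕ)
    (hg : ∀ a c', c' ≤ c + p.maxQueries → c' + (g (a, c')).maxQueries ≤ W) :
    c + ((p.counted c).bind g).maxQueries ≤ W := by
  induction p generalizing c with
  | ret a => exact hg a c (by simp)
  | query i k ih =>
    have h : ∀ y, c + 1 + (((k y).counted (c + 1)).bind g).maxQueries ≤ W := by
      intro y
      refine ih y (c + 1) fun a c' hc' => hg a c' (hc'.trans ?_)
      have := le_sup (f := fun y => (k y).maxQueries) (mem_univ y)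
      simp only [maxQueries]
      omega
    -- Some answer exists because `q ≠ 0`; this gives `c + 1 ≤ W`, so the truncated subtraction
    -- below is exact.
    have h0 := h 0
    have : (univ.sup fun y => (((k y).counted (c + 1)).bind g).maxQueries) ≤ W - (c + 1) :=
      Finset.sup_le fun y _ => by have := h y; omega
    simp only [counted, bind, maxQueries]
    omega
  | run C k ih =>
    have h : ∀ y, c + C.T + (((k y).counted (c + C.T)).bind g).maxQueries ≤ W := by
      intro y
      refine ih y (c + C.T) fun a c' hc' => hg a c' (hc'.trans ?_)
      have := le_sup (f := fun y => (k y).maxQueries) (mem_univ y)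
      simp only [maxQueries]
      omega
    have h0 := h C.start
    have : (univ.sup fun y => (((k y).counted (c + C.T)).bind g).maxQueries) ≤ W - (c + C.T) :=
      Finset.sup_le fun y _ => by have := h y; omega
    simp only [counted, bind, maxQueries]
    omega

theorem maxQueries_bind_le {r : ℕ} (g : α → QProg I q β) (p : QProg I q α)
    (hg : ∀ a, (g a).maxQueries ≤ r) : (p.bind g).maxQueries ≤ p.maxQueries + r := by
  induction p with
  | ret a => simpa [bind, maxQueries] using hg a
  | query i k ih =>
    simp only [bind, maxQueries, add_assoc]
    gcongr
    refine Finset.sup_le fun y hy => (ih y).trans ?_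
    gcongr
    exact le_sup (f := fun y => (k y).maxQueries) hy
  | run C k ih =>
    simp only [bind, maxQueries, add_assoc]
    gcongr
    refine Finset.sup_le fun y hy => (ih y).trans ?_
    gcongr
    exact le_sup (f := fun y => (k y).maxQueries) hy

theorem expQueries_bind_le [NeZero q] {r : ℕ} (x : I → Fin q) (g : α → QProg I q β)
    (p : QProg I q α) (hg : ∀ a, (g a).maxQueries ≤ r) :
    (p.bind g).expQueries x ≤ p.expQueries x + r := by
  unfold expQueries
  rw [expect_bind]
  calc _ ≤ expect x (fun _ c => (c : ℝ) + r) 0 p := by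
        refine expect_mono (surely_true x p) (fun a c _ => ?_) 0
        rw [expect_queries]
        have h1 := expQueries_le_maxQueries x (g a)
        have h2 : ((g a).maxQueries : ℝ) ≤ r := by exact_mod_cast hg a
        linarith
    _ = _ := by rw [expect_add x (fun _ c => (c : ℝ)), expect_const]

theorem prob_nonneg (x : I → Fin q) (E : Set α) (p : QProg I q α) : 0 ≤ p.prob x E := by
  induction p with
  | ret a => exact Set.indicator_nonneg (fun _ _ => zero_le_one) a
  | query i k ih => exact ih _
  | run C k ih => exact sum_nonneg fun b _ => mul_nonneg (C.outcomeProb_nonneg x b) (ih b)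

end QProg

end QueryPrograms

/-! ## Grover search with a prescribed number of solutions -/

section Grover

open Finset

/-- The reflection `ψ ↦ 2⟨r, ψ⟩ r - ψ`. -/
noncomputable def reflectionMatrix {β : Type} [DecidableEq β] (r : β → ℝ) : Matrix β β ℂ :=
  fun b c => 2 * r b * r c - if b = c then 1 else 0

theorem reflectionMatrix_mulVec {β : Type} [Fintype β] [DecidableEq β] (r : β → ℝ) (ψ : β → ℂ)
    (b : β) : (reflectionMatrix r).mulVec ψ b = 2 * (∑ c, r c * ψ c) * r b - ψ b := by
  simp only [Matrix.mulVec, dotProduct, reflectionMatrix, sub_mul, sum_sub_distrib, ite_mul,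
    one_mul, zero_mul, sum_ite_eq, mem_univ, if_true, mul_sum, sum_mul]
  congr 1
  exact sum_congr rfl fun c _ => by ring

theorem reflectionMatrix_mem {β : Type} [Fintype β] [DecidableEq β] {r : β → ℝ}
    (hr : ∑ b, r b ^ 2 = 1) : reflectionMatrix r ∈ Matrix.unitaryGroup β ℂ := by
  rw [Matrix.mem_unitaryGroup_iff]
  have hstar : star (reflectionMatrix r) = reflectionMatrix r := by
    ext b c
    rw [Matrix.star_apply]
    by_cases h : b = c
    · subst h; simp [reflectionMatrix]
    · simp [reflectionMatrix, h, Ne.symm h]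
      ring
  have hr' : ∑ b, (r b : ℂ) * r b = 1 := by
    rw [← Complex.ofReal_one, ← hr, Complex.ofReal_sum]
    exact sum_congr rfl fun b _ => by push_cast; ring
  rw [hstar]
  ext b c
  change (reflectionMatrix r).mulVec (fun d => reflectionMatrix r d c) b = _
  rw [reflectionMatrix_mulVec]
  have hsum : ∑ d, (r d : ℂ) * reflectionMatrix r d c = r c := by
    calc ∑ d, (r d : ℂ) * reflectionMatrix r d c
        = ∑ d, (2 * r c * ((r d : ℂ) * r d) - if d = c then (r d : ℂ) else 0) :=
          sum_congr rfl fun d _ => by simp only [reflectionMatrix]; split_ifs <;> ring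
      _ = r c := by
          rw [sum_sub_distrib, ← mul_sum, hr', sum_ite_eq' univ c, if_pos (mem_univ c)]; ring
  rw [hsum, reflectionMatrix, Matrix.one_apply]
  ring

/-- A reflection exchanging two real unit vectors, here the basis vector `e` and `s`. -/
theorem reflectionMatrix_mulVec_single {β : Type} [Fintype β] [DecidableEq β] {s : β → ℝ} {e : β}
    (he : 0 ≤ s e) (b : β) :
    (reflectionMatrix fun b => (s b + (Pi.single e 1 : β → ℝ) b) / √(2 + 2 * s e)).mulVec
      (Pi.single e 1) b = s b := by
  have h2 : (√(2 + 2 * s e) : ℂ) ^ 2 = 2 + 2 * s e := by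
    rw [← Complex.ofReal_pow, Real.sq_sqrt (by linarith)]; push_cast; ring
  have h0 : (√(2 + 2 * s e) : ℂ) ≠ 0 := by
    intro h
    rw [h] at h2
    have : (2 + 2 * s e : ℝ) = 0 := by
      have h2' : (2 + 2 * s e : ℂ) = 0 := by rw [← h2]; simp
      exact_mod_cast h2'
    linarith
  have h3 : (2 + 2 * s e : ℂ) ≠ 0 := by rw [← h2]; exact pow_ne_zero 2 h0
  rw [reflectionMatrix_mulVec, sum_eq_single e]
  · have hs : ((Pi.single e 1 : β → ℝ) b : ℂ) = (Pi.single e 1 : β → ℂ) b := by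
      by_cases h : b = e
      · subst h; simp
      · simp [h]
    simp only [Pi.single_eq_same, Complex.ofReal_div, Complex.ofReal_add, hs, Complex.ofReal_one,
      mul_one]
    have : 2 * (((s e : ℂ) + 1) / √(2 + 2 * s e)) *
        ((s b + (Pi.single e 1 : β → ℂ) b) / √(2 + 2 * s e)) =
        s b + (Pi.single e 1 : β → ℂ) b := by
      have : 2 * (((s e : ℂ) + 1) / √(2 + 2 * s e)) *
        ((s b + (Pi.single e 1 : β → ℂ) b) / √(2 + 2 * s e)) =
        (2 + 2 * s e) * (s b + (Pi.single e 1 : β → ℂ) b) / (√(2 + 2 * s e) : ℂ) ^ 2 := by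
        field_simp
        ring
      rw [this, h2, mul_div_cancel_left₀ _ h3]
    rw [this]; ring
  · intro c _ hc
    simp [hc]
  · simp

theorem sum_sq_bisector {β : Type} [Fintype β] [DecidableEq β] {s : β → ℝ} {e : β}
    (hs : ∑ b, s b ^ 2 = 1) (he : 0 ≤ s e) :
    ∑ b, ((s b + (Pi.single e 1 : β → ℝ) b) / √(2 + 2 * s e)) ^ 2 = 1 := by
  have h0 : 0 < 2 + 2 * s e := by linarith
  have h1 : ∀ b, (s b + (Pi.single e 1 : β → ℝ) b) ^ 2 =
      s b ^ 2 + if b = e then 1 + 2 * s e else 0 := by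
    intro b
    split_ifs with h
    · subst h; simp; ring
    · simp [h]
  simp only [div_pow, Real.sq_sqrt h0.le]
  rw [← sum_div, div_eq_one_iff_eq h0.ne']
  simp only [h1, sum_add_distrib, hs, sum_ite_eq', mem_univ, if_true]
  ring

variable {I : Type} [Fintype I] [DecidableEq I] {q : ℕ}

/-- Between the two queries of a Grover iteration: the phase `-1` on good entries and the
negation of the answer register, so that the second query clears this register. -/
noncomputable def phaseMatrix [NeZero q] (good : I → Fin q → Prop) :
    Matrix (QBasis I q 1) (QBasis I q 1) ℂ :=
  open Classical in
  fun b c => if c = (b.1, -b.2.1, b.2.2) then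
    if ∃ i, c.1 = some i ∧ good i c.2.1 then -1 else 1 else 0

theorem phaseMatrix_mulVec [NeZero q] (good : I → Fin q → Prop) (ψ : QBasis I q 1 → ℂ)
    (b : QBasis I q 1) : open Classical in (phaseMatrix good).mulVec ψ b =
      (if ∃ i, b.1 = some i ∧ good i (-b.2.1) then -1 else 1) * ψ (b.1, -b.2.1, b.2.2) := by
  simp only [Matrix.mulVec, dotProduct, phaseMatrix, ite_mul, zero_mul, sum_ite_eq', mem_univ,
    if_true]

theorem phaseMatrix_mem [NeZero q] (good : I → Fin q → Prop) :
    phaseMatrix good ∈ Matrix.unitaryGroup (QBasis I q 1) ℂ := by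
  classical
  rw [Matrix.mem_unitaryGroup_iff]
  ext b c
  rw [Matrix.mul_apply, sum_eq_single (b.1, -b.2.1, b.2.2)]
  · by_cases h : b = c
    · subst h
      simp only [phaseMatrix, if_true, Matrix.star_apply, Matrix.one_apply_eq]
      split_ifs <;> simp
    · have h' : (b.1, -b.2.1, b.2.2) ≠ (c.1, -c.2.1, c.2.2) := by
        intro h'
        apply h
        simp only [Prod.mk.injEq, neg_inj] at h'
        exact Prod.ext h'.1 (Prod.ext h'.2.1 h'.2.2)
      simp [phaseMatrix, h, Matrix.star_apply, h']
  · intro d _ hd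
    simp [phaseMatrix, hd]
  · simp

/-- Amplitudes with clean answer register: `A * a` on `G`, `B * a` on the rest of `P`, and `B * b`
where nothing is queried. -/
def groverVec [NeZero q] (P G : Finset I) (a b A B : ℝ) : QBasis I q 1 → ℝ
  | (none, y, _) => if y = 0 then B * b else 0
  | (some i, y, _) => if y = 0 then if i ∈ G then A * a else if i ∈ P then B * a else 0 else 0

theorem sum_groverVec_mul [NeZero q] {P G : Finset I} (hG : G ⊆ P) (a b A B : ℝ) :
    ∑ c : QBasis I q 1, groverVec P G a b 1 1 c * groverVec P G a b A B c =
      A * (#G * a ^ 2) + B * ((#P - #G) * a ^ 2 + b ^ 2) := by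
  have hy : ∀ (y : Fin q) (u v : ℝ), (if y = 0 then u else 0) * (if y = 0 then v else 0) =
      if y = 0 then u * v else 0 := by intro y u v; split_ifs <;> simp
  have h1 : ∀ i, (if i ∈ G then 1 * a else if i ∈ P then 1 * a else 0) *
      (if i ∈ G then A * a else if i ∈ P then B * a else 0) =
      (if i ∈ G then (A - B) * a ^ 2 else 0) + (if i ∈ P then B * a ^ 2 else 0) := by
    intro i
    by_cases hi : i ∈ G
    · simp [hi, hG hi]; ring
    · by_cases hp : i ∈ P <;> simp [hi, hp]; ring
  simp only [Fintype.sum_prod_type, Fintype.sum_option, groverVec, hy, univ_unique,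
    sum_singleton, sum_ite_eq', mem_univ, if_true, h1, sum_add_distrib, sum_ite_mem, univ_inter,
    sum_const, nsmul_eq_mul]
  ring

/-- With both coefficients equal to `1` the split into good and bad positions disappears, so the
reflection about the start vector can be built with `∅`, independently of the input. -/
theorem groverVec_eq {I : Type} [DecidableEq I] [NeZero q] (P G : Finset I) (hG : G ⊆ P) (a b : ℝ) :
    (groverVec P G a b 1 1 : QBasis I q 1 → ℝ) = groverVec P ∅ a b 1 1 := by
  ext ⟨o, y, z⟩
  cases o with
  | none => rfl
  | some i =>
    by_cases hi : i ∈ G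
    · simp [groverVec, hi, hG hi]
    · simp [groverVec, hi]

theorem sum_sq_groverVec [NeZero q] {P : Finset I} {a : ℝ} (h : #P * a ^ 2 ≤ 1) :
    ∑ c : QBasis I q 1, groverVec P ∅ a (√(1 - #P * a ^ 2)) 1 1 c ^ 2 = 1 := by
  have := sum_groverVec_mul (q := q) (empty_subset P) a (√(1 - #P * a ^ 2)) 1 1
  rw [Real.sq_sqrt (by linarith)] at this
  simp only [← sq] at this
  rw [this]
  simp

/-- Grover's algorithm with `k` iterations, searching in `P` for `i` with `good i (x i)`, that
starts with amplitude `a` on every position in `P`. -/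
noncomputable def groverCircuit [NeZero q] (P : Finset I) (good : I → Fin q → Prop) (a : ℝ)
    (h : #P * a ^ 2 ≤ 1) (k : ℕ) : QCircuit I q where
  w := 1
  T := 2 * k
  U t :=
    if t = 0 then ⟨_, reflectionMatrix_mem
      (sum_sq_bisector (e := ((none, 0, 0) : QBasis I q 1)) (sum_sq_groverVec h)
        (by simp [groverVec]))⟩
    else if Even t then ⟨_, reflectionMatrix_mem (sum_sq_groverVec h)⟩
    else ⟨_, phaseMatrix_mem good⟩
  start := (none, 0, 0)

/-- The coefficients after `k` Grover iterations, where `w` is the initial probability of the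
good positions. -/
def groverCoeff (w : ℝ) : ℕ → ℝ × ℝ
  | 0 => (1, 1)
  | k + 1 => ((1 - 2 * w) * (groverCoeff w k).1 + 2 * (1 - w) * (groverCoeff w k).2,
      -2 * w * (groverCoeff w k).1 + (1 - 2 * w) * (groverCoeff w k).2)

/-- One Grover iteration rotates by `2 * θ` in the plane of good and bad components. The products
with `sin θ` and `cos θ` avoid dividing by either, as both may vanish. -/
theorem groverCoeff_eq {w θ : ℝ} (hw : w = Real.sin θ ^ 2) (k : ℕ) :
    (groverCoeff w k).1 * Real.sin θ = Real.sin ((2 * k + 1) * θ) ∧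
      (groverCoeff w k).2 * Real.cos θ = Real.cos ((2 * k + 1) * θ) := by
  induction k with
  | zero => simp [groverCoeff]
  | succ k ih =>
    have e : (2 * ((k + 1 : ℕ) : ℝ) + 1) * θ = (2 * k + 1) * θ + 2 * θ := by push_cast; ring
    have hc : 1 - w = Real.cos θ ^ 2 := by rw [hw, ← Real.sin_sq_add_cos_sq θ]; ring
    have hc2 : Real.cos (2 * θ) = 1 - 2 * w := by rw [Real.cos_two_mul, ← hc]; ring
    rw [e, Real.sin_add, Real.cos_add, ← ih.1, ← ih.2, hc2, Real.sin_two_mul]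
    simp only [groverCoeff, hc]
    constructor
    · ring
    · rw [hw]; ring

/-- The state stays in a plane: one coefficient on the good positions, the other on the remaining
positions together with the `none` state, which holds the amplitude left over by the choice of `a`
and counts as bad. -/
theorem groverCircuit_state [NeZero q] (P : Finset I) (good : I → Fin q → Prop) (a : ℝ)
    (h : #P * a ^ 2 ≤ 1) (K : ℕ) (x : I → Fin q) (G : Finset I)
    (hG : ∀ i, i ∈ G ↔ i ∈ P ∧ good i (x i)) (k : ℕ) (b : QBasis I q 1) :
    (groverCircuit P good a h K).state x (2 * k) b =
      (groverVec P G a (√(1 - #P * a ^ 2)) (groverCoeff (#G * a ^ 2) k).1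
        (groverCoeff (#G * a ^ 2) k).2 b : ℂ) := by
  have hGP : G ⊆ P := fun i hi => ((hG i).1 hi).1
  have hb2 : √(1 - #P * a ^ 2) ^ 2 = 1 - #P * a ^ 2 := Real.sq_sqrt (by linarith)
  set β := √(1 - #P * a ^ 2) with hβ
  induction k generalizing b with
  | zero =>
    have := reflectionMatrix_mulVec_single (s := groverVec P ∅ a β 1 1)
      (e := ((none, 0, 0) : QBasis I q 1)) (by simp [groverVec, hβ]) b
    simp only [groverCoeff, groverVec_eq P G hGP a β, ← this]
    rfl
  | succ k ih =>
    set A := (groverCoeff (#G * a ^ 2) k).1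
    set B := (groverCoeff (#G * a ^ 2) k).2
    -- The first query writes `x i` into the answer register, the phase matrix marks the good
    -- positions and replaces `x i` by `-x i`, and the second query clears the register. The net
    -- effect is `A ↦ -A`.
    have hmid : ∀ c, queryOp x ((phaseMatrix good).mulVec (queryOp x
        ((groverCircuit P good a h K).state x (2 * k)))) c =
        (groverVec P G a β (-A) B c : ℂ) := by
      rintro ⟨o, y, z⟩
      cases o with
      | none =>
        simp only [queryOp, phaseMatrix_mulVec]
        erw [ih]
        simp [groverVec]
      | some i =>
        simp only [queryOp, phaseMatrix_mulVec]
        erw [ih]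
        have e2 : -(y - x i) = x i - y := by abel
        simp only [e2, Option.some.injEq, exists_eq_left', groverVec]
        by_cases hy : y = 0
        · subst hy
          by_cases hi : i ∈ G
          · have := (hG i).1 hi
            simp [hi, this.2]
          · by_cases hp : i ∈ P
            · have : ¬ good i (x i) := fun hg => hi ((hG i).2 ⟨hp, hg⟩)
              simp [hi, hp, this]
            · simp [hi, hp]
        · simp [hy]
    have hstep : (groverCircuit P good a h K).state x (2 * (k + 1)) =
        (reflectionMatrix (groverVec P ∅ a β 1 1)).mulVec (queryOp x
          ((phaseMatrix good).mulVec (queryOp x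
            ((groverCircuit P good a h K).state x (2 * k))))) := by
      have e : 2 * (k + 1) = 2 * k + 1 + 1 := by ring
      rw [e]
      simp only [QCircuit.state]
      congr 2
      · simp only [groverCircuit]
        rw [if_neg (by omega), if_pos (by use k + 1; omega)]
      · congr 2
        simp only [groverCircuit]
        rw [if_neg (by omega), if_neg (by rw [Nat.not_even_iff_odd]; use k)]
    rw [hstep, reflectionMatrix_mulVec]
    simp only [hmid]
    have hsum := sum_groverVec_mul (q := q) hGP a β (-A) B
    rw [groverVec_eq P G hGP a β] at hsum
    have hsum' : ∑ c : QBasis I q 1, (groverVec P ∅ a β 1 1 c : ℂ) * groverVec P G a β (-A) B c =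
        ((-A * (#G * a ^ 2) + B * ((#P - #G) * a ^ 2 + β ^ 2) : ℝ) : ℂ) := by
      rw [← hsum]; push_cast; rfl
    rw [hsum', ← groverVec_eq P G hGP a β, hb2]
    norm_cast
    obtain ⟨o, y, z⟩ := b
    cases o with
    | none =>
      simp only [groverVec, groverCoeff]
      split_ifs <;> push_cast <;> ring
    | some i =>
      simp only [groverVec, groverCoeff]
      split_ifs <;> push_cast <;> ring

/-- The probability that Grover's algorithm finds a good position. -/
theorem groverCircuit_success [NeZero q] (P : Finset I) (good : I → Fin q → Prop) (a : ℝ)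
    (h : #P * a ^ 2 ≤ 1) (k : ℕ) (x : I → Fin q) (G : Finset I)
    (hG : ∀ i, i ∈ G ↔ i ∈ P ∧ good i (x i)) {θ : ℝ} (hθ : #G * a ^ 2 = Real.sin θ ^ 2) :
    ∑ b : QBasis I q 1, (if ∃ i ∈ G, b.1 = some i then
      (groverCircuit P good a h k).outcomeProb x b else 0) = Real.sin ((2 * k + 1) * θ) ^ 2 := by
  classical
  set A := (groverCoeff (#G * a ^ 2) k).1 with hA
  have h1 : ∀ b : QBasis I q 1, (if ∃ i ∈ G, b.1 = some i then
      (groverCircuit P good a h k).outcomeProb x b else 0) =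
      if ∃ i ∈ G, b.1 = some i then (if b.2.1 = 0 then A ^ 2 * a ^ 2 else 0) else 0 := by
    rintro ⟨o, y, z⟩
    refine ite_congr rfl ?_ fun _ => rfl
    rintro ⟨i, hi, ho⟩
    simp only at ho
    subst ho
    unfold QCircuit.outcomeProb
    erw [groverCircuit_state P good a h k x G hG k]
    rw [Complex.norm_real, Real.norm_eq_abs, sq_abs]
    simp only [groverVec, hi, if_true, ← hA]
    split_ifs <;> simp [mul_pow]
  simp only [h1]
  rw [← (groverCoeff_eq hθ k).1, mul_pow, ← hθ]
  simp only [Fintype.sum_prod_type, Fintype.sum_option, univ_unique, sum_singleton,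
    Option.some.injEq, exists_eq_right', reduceCtorEq, and_false, exists_false, if_false,
    sum_const_zero, zero_add]
  have : ∀ i, (∑ y : Fin q, if i ∈ G then if y = 0 then A ^ 2 * a ^ 2 else 0 else 0) =
      if i ∈ G then A ^ 2 * a ^ 2 else 0 := by
    intro i
    split_ifs <;> simp
  simp only [this, sum_ite_mem, univ_inter, sum_const, nsmul_eq_mul, ← hA]
  ring

end Grover

/-! ## Search with a list of guesses for the number of solutions -/

section Guesses

open Finset

/-- Number of Grover iterations for `N` positions, `g` of which are supposed to be solutions. -/
noncomputable def groverIters (N g : ℕ) : ℕ := ⌈√((N : ℝ) / g)⌉₊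

/-- The angle that is rotated to `π / 2` by `groverIters N g` Grover iterations. -/
noncomputable def groverAngle (N g : ℕ) : ℝ := Real.pi / (2 * (2 * groverIters N g + 1))

/-- The initial amplitude for which `g` solutions out of `N` are found with certainty. -/
noncomputable def groverAmplitude (N g : ℕ) : ℝ := Real.sin (groverAngle N g) / √g

theorem groverAngle_pos (N g : ℕ) : 0 < groverAngle N g := by
  unfold groverAngle; positivity

theorem mul_groverAngle (N g : ℕ) :
    (2 * (groverIters N g : ℝ) + 1) * groverAngle N g = Real.pi / 2 := by
  unfold groverAngle
  have : (2 * (groverIters N g : ℝ) + 1) ≠ 0 := by positivity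
  field_simp

theorem groverAngle_le (N g : ℕ) : groverAngle N g ≤ Real.pi / 2 := by
  rw [← mul_groverAngle N g]
  have := (groverAngle_pos N g).le
  have : (0 : ℝ) ≤ groverIters N g := by positivity
  nlinarith

theorem sin_groverAngle_nonneg (N g : ℕ) : 0 ≤ Real.sin (groverAngle N g) :=
  Real.sin_nonneg_of_nonneg_of_le_pi (groverAngle_pos N g).le
    ((groverAngle_le N g).trans (by linarith [Real.pi_pos]))

theorem groverAmplitude_nonneg (N g : ℕ) : 0 ≤ groverAmplitude N g :=
  div_nonneg (sin_groverAngle_nonneg N g) (Real.sqrt_nonneg _)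

/-- With `k` iterations and angle `θ`, one has `k ≥ √(N / g)` and `k * θ ≤ π / 4 < 1`, hence `N *
sin θ ^ 2 ≤ g * (k * θ) ^ 2 ≤ g`. Thus the prescribed amplitude on all `N` positions leaves a
nonnegative probability for the `none` state. -/
theorem mul_groverAmplitude_sq_le (N g : ℕ) : N * groverAmplitude N g ^ 2 ≤ 1 := by
  unfold groverAmplitude
  rcases Nat.eq_zero_or_pos g with rfl | hg
  · simp
  have hg' : (0 : ℝ) < g := by exact_mod_cast hg
  rw [div_pow, Real.sq_sqrt hg'.le, ← mul_div_assoc, div_le_one hg']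
  have h1 : Real.sin (groverAngle N g) ≤ groverAngle N g := Real.sin_le (groverAngle_pos N g).le
  have h2 : √((N : ℝ) / g) ≤ groverIters N g := Nat.le_ceil _
  have h3 : (N : ℝ) / g ≤ (groverIters N g : ℝ) ^ 2 := by
    rw [← Real.sq_sqrt (show (0 : ℝ) ≤ N / g by positivity)]
    gcongr
  have h4 : (N : ℝ) ≤ groverIters N g ^ 2 * g := (div_le_iff₀ hg').1 h3
  have h5 : groverIters N g * groverAngle N g ≤ 1 := by
    have := mul_groverAngle N g
    have := groverAngle_pos N g
    nlinarith [Real.pi_lt_four]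
  have h6 := sin_groverAngle_nonneg N g
  calc (N : ℝ) * Real.sin (groverAngle N g) ^ 2
      ≤ (groverIters N g ^ 2 * g) * groverAngle N g ^ 2 := by gcongr
    _ = (groverIters N g * groverAngle N g) ^ 2 * g := by ring
    _ ≤ 1 ^ 2 * g := by
        have := (groverAngle_pos N g).le
        gcongr
    _ = g := by ring

/-- Success probability for the guess `g` if there are `t` solutions. -/
noncomputable def groverProb (N t g : ℕ) : ℝ :=
  Real.sin ((2 * groverIters N g + 1) * Real.arcsin (√t * groverAmplitude N g)) ^ 2

theorem groverProb_nonneg (N t g : ℕ) : 0 ≤ groverProb N t g := sq_nonneg _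

theorem groverProb_le_one (N t g : ℕ) : groverProb N t g ≤ 1 := Real.sin_sq_le_one _

theorem groverProb_self {N g : ℕ} (hg : 1 ≤ g) : groverProb N g g = 1 := by
  have hg' : √(g : ℝ) ≠ 0 := by positivity
  unfold groverProb groverAmplitude
  rw [mul_div_cancel₀ _ hg', Real.arcsin_sin (by linarith [groverAngle_pos N g, Real.pi_pos])
    (groverAngle_le N g), mul_groverAngle]
  simp

/-- An overestimate never overshoots: the final angle is at most `π / 2`, and it is at least `√(t /
g)`. Jordan's inequality `sin φ ≥ 2 φ / π` then applies, and `4 / π ^ 2 ≥ 2 / 5`. -/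
theorem le_groverProb {N t g : ℕ} (hg : 1 ≤ g) (htg : t ≤ g) :
    2 / 5 * (t / g : ℝ) ≤ groverProb N t g := by
  have hg' : (0 : ℝ) < g := by positivity
  set k := groverIters N g
  set s := √t * groverAmplitude N g with hs
  set r := √((t : ℝ) / g) with hr
  have hr1 : r ≤ 1 := by
    rw [hr, Real.sqrt_le_one, div_le_one hg']; exact_mod_cast htg
  have hsr : s = r * Real.sin (groverAngle N g) := by
    rw [hs, hr, groverAmplitude, Real.sqrt_div (by positivity)]; ring
  have hsin := sin_groverAngle_nonneg N g
  have hs0 : 0 ≤ s := mul_nonneg (Real.sqrt_nonneg _) (groverAmplitude_nonneg N g)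
  have hsle : s ≤ Real.sin (groverAngle N g) := by
    rw [hsr]; exact mul_le_of_le_one_left hsin hr1
  have hs1 : s ≤ 1 := hsle.trans (Real.sin_le_one _)
  have hup : Real.arcsin s ≤ groverAngle N g := by
    have := Real.monotone_arcsin hsle
    rwa [Real.arcsin_sin (by linarith [groverAngle_pos N g, Real.pi_pos])
      (groverAngle_le N g)] at this
  have hlow : s ≤ Real.arcsin s := by
    have := Real.sin_le (Real.arcsin_nonneg.2 hs0)
    rwa [Real.sin_arcsin (by linarith) hs1] at this
  have hang : 2 / Real.pi * groverAngle N g ≤ Real.sin (groverAngle N g) :=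
    Real.mul_le_sin (groverAngle_pos N g).le (groverAngle_le N g)
  have hk : (0 : ℝ) < 2 * k + 1 := by positivity
  have hφ1 : (2 * k + 1) * Real.arcsin s ≤ Real.pi / 2 := by
    rw [← mul_groverAngle N g]; gcongr
  have hφ0 : r ≤ (2 * k + 1) * Real.arcsin s := by
    calc r = r * (2 / Real.pi * (Real.pi / 2)) := by
          have := Real.pi_ne_zero
          field_simp
      _ = (2 * k + 1) * (r * (2 / Real.pi * groverAngle N g)) := by
          rw [← mul_groverAngle N g]; ring
      _ ≤ (2 * k + 1) * (r * Real.sin (groverAngle N g)) := by gcongr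
      _ = (2 * k + 1) * s := by rw [hsr]
      _ ≤ _ := by gcongr
  have hr0 : 0 ≤ r := Real.sqrt_nonneg _
  have hfin : 2 / Real.pi * r ≤ Real.sin ((2 * k + 1) * Real.arcsin s) :=
    le_trans (by gcongr) (Real.mul_le_sin (hr0.trans hφ0) hφ1)
  calc 2 / 5 * (t / g : ℝ) ≤ (2 / Real.pi) ^ 2 * (t / g : ℝ) := by
        gcongr
        rw [div_pow, div_le_div_iff₀ (by norm_num) (by positivity)]
        have := Real.pi_lt_d2
        have := Real.pi_pos
        nlinarith
    _ = (2 / Real.pi * r) ^ 2 := by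
        rw [mul_pow, hr, Real.sq_sqrt (by positivity)]
    _ ≤ _ := by
        unfold groverProb
        gcongr

/-! ### Grover runs with classical checks -/

variable {I : Type} [Fintype I] [DecidableEq I] {q N : ℕ}

/-- Grover's algorithm for the guess that there are `g` solutions. -/
noncomputable def guessCircuit [NeZero q] (e : Fin N → I) (good : Fin N → Fin q → Prop) (g : ℕ) :
    QCircuit I q :=
  groverCircuit (univ.image e) (fun i y => ∃ j, e j = i ∧ good j y) (groverAmplitude N g)
    ((mul_le_mul_of_nonneg_right (by
      have := card_image_le (s := univ) (f := e)
      rw [card_univ, Fintype.card_fin] at this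
      exact_mod_cast this) (sq_nonneg _)).trans (mul_groverAmplitude_sq_le N g))
    (groverIters N g)

open Classical in
/-- Check the measured position with one query, and continue with `p` if it is not good. -/
noncomputable def checkPosition (e : Fin N → I) (good : Fin N → Fin q → Prop)
    (p : QProg I q (Option (Fin N))) (o : Option I) : QProg I q (Option (Fin N)) :=
  match o.bind (Function.partialInv e) with
  | none => p
  | some j => QProg.query (e j) fun y => if good j y then QProg.ret (some j) else p

/-- Run Grover's algorithm with each guess in the list until a good position is found. -/
noncomputable def guessSearch [NeZero q] (e : Fin N → I) (good : Fin N → Fin q → Prop) :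
    List ℕ → QProg I q (Option (Fin N))
  | [] => QProg.ret none
  | g :: gs => QProg.run (guessCircuit e good g) fun b =>
      checkPosition e good (guessSearch e good gs) b.1

/-- Maximal number of queries for the guess `g`, including the check. -/
noncomputable def guessCost (N g : ℕ) : ℝ := 2 * groverIters N g + 1

/-- Bound for the worst-case number of queries with a list of guesses. -/
noncomputable def worstCost (N : ℕ) : List ℕ → ℝ
  | [] => 0
  | g :: gs => guessCost N g + worstCost N gs

/-- Bound for the expected number of queries with a list of guesses if there are `t` solutions. -/
noncomputable def expCost (N t : ℕ) : List ℕ → ℝ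
  | [] => 0
  | g :: gs => guessCost N g + (1 - groverProb N t g) * expCost N t gs

/-- Probability that no solution is found with a list of guesses if there are `t` of them. -/
noncomputable def failProb (N t : ℕ) : List ℕ → ℝ
  | [] => 1
  | g :: gs => (1 - groverProb N t g) * failProb N t gs

theorem maxQueries_checkPosition (e : Fin N → I) (good : Fin N → Fin q → Prop)
    (p : QProg I q (Option (Fin N))) (o : Option I) :
    (checkPosition e good p o).maxQueries ≤ p.maxQueries + 1 := by
  unfold checkPosition
  split
  · omega
  · simp only [QProg.maxQueries]
    rw [add_comm]
    gcongr
    refine Finset.sup_le fun y _ => ?_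
    split_ifs
    · simp [QProg.maxQueries]
    · exact le_rfl

theorem maxQueries_guessSearch [NeZero q] (e : Fin N → I) (good : Fin N → Fin q → Prop) (gs : List ℕ) :
    ((guessSearch e good gs).maxQueries : ℝ) ≤ worstCost N gs := by
  induction gs with
  | nil => simp [guessSearch, QProg.maxQueries, worstCost]
  | cons g gs ih =>
    have h : (guessSearch e good (g :: gs)).maxQueries ≤
        2 * groverIters N g + ((guessSearch e good gs).maxQueries + 1) := by
      simp only [guessSearch, QProg.maxQueries]
      exact Nat.add_le_add le_rfl
        (Finset.sup_le fun b _ => maxQueries_checkPosition e good _ b.1)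
    have h' : ((guessSearch e good (g :: gs)).maxQueries : ℝ) ≤
        2 * groverIters N g + ((guessSearch e good gs).maxQueries + 1) := by exact_mod_cast h
    simp only [worstCost, guessCost]
    linarith

/-- The two alternatives without success differ in the check: a measured index outside the row costs
no query, a wrong position of the row costs one. -/
theorem expect_checkPosition {e : Fin N → I} (he : Function.Injective e)
    (good : Fin N → Fin q → Prop) (p : QProg I q (Option (Fin N))) (o : Option I)
    (x : I → Fin q) (h : Option (Fin N) → ℕ → ℝ) (c : ℕ) :
    open Classical in
    if ∃ j, o = some (e j) ∧ good j (x (e j)) then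
      ∃ j, QProg.expect x h c (checkPosition e good p o) = h (some j) (c + 1)
    else QProg.expect x h c (checkPosition e good p o) = QProg.expect x h c p ∨
      QProg.expect x h c (checkPosition e good p o) = QProg.expect x h (c + 1) p := by
  classical
  have hinv : ∀ j, Function.partialInv e (e j) = some j := Function.partialInv_left he
  split_ifs with H
  · obtain ⟨j, rfl, hj⟩ := H
    refine ⟨j, ?_⟩
    simp [checkPosition, hinv, QProg.expect, hj]
  · rcases hb : o.bind (Function.partialInv e) with _ | j
    · left
      simp [checkPosition, hb]
    · right
      obtain ⟨i, rfl, hi⟩ := Option.bind_eq_some_iff.1 hb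
      have hij : e j = i := (he.isPartialInv j i).1 hi
      have hg : ¬ good j (x (e j)) := fun hg => H ⟨j, by rw [hij], hg⟩
      simp [checkPosition, hb, QProg.expect, hg]

variable [NeZero q]

theorem guessCircuit_success {e : Fin N → I} (he : Function.Injective e)
    (good : Fin N → Fin q → Prop) (g : ℕ) (x : I → Fin q) (s : Finset (Fin N))
    (hs : ∀ j, j ∈ s ↔ good j (x (e j))) : open Classical in
    ∑ b, (if ∃ j, b.1 = some (e j) ∧ good j (x (e j)) then
      (guessCircuit e good g).outcomeProb x b else 0) = groverProb N (#s) g := by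
  classical
  have hcard : #(s.image e) = #s := card_image_of_injective s he
  have hsN : #s ≤ N := by simpa using card_le_univ s
  have hw : (#(s.image e) : ℝ) * groverAmplitude N g ^ 2 =
      Real.sin (Real.arcsin (√(#s) * groverAmplitude N g)) ^ 2 := by
    have h0 := groverAmplitude_nonneg N g
    have h1 : (√(#s) * groverAmplitude N g) ^ 2 ≤ 1 := by
      rw [mul_pow, Real.sq_sqrt (by positivity)]
      refine le_trans ?_ (mul_groverAmplitude_sq_le N g)
      gcongr
    have h2 : √(#s) * groverAmplitude N g ≤ 1 := by
      by_contra! h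
      nlinarith
    rw [Real.sin_arcsin (by linarith [mul_nonneg (Real.sqrt_nonneg (#s : ℝ)) h0]) h2, mul_pow,
      Real.sq_sqrt (by positivity), hcard]
  have hG : ∀ i, i ∈ s.image e ↔ i ∈ univ.image e ∧ ∃ j, e j = i ∧ good j (x i) := by
    intro i
    simp only [mem_image, mem_univ, true_and]
    constructor
    · rintro ⟨j, hj, rfl⟩
      exact ⟨⟨j, rfl⟩, j, rfl, (hs j).1 hj⟩
    · rintro ⟨-, j, rfl, hj⟩
      exact ⟨j, (hs j).2 hj, rfl⟩
  have := groverCircuit_success (univ.image e) (fun i y => ∃ j, e j = i ∧ good j y)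
    (groverAmplitude N g) ((mul_le_mul_of_nonneg_right (by
      have := card_image_le (s := univ) (f := e)
      rw [card_univ, Fintype.card_fin] at this
      exact_mod_cast this) (sq_nonneg _)).trans (mul_groverAmplitude_sq_le N g))
    (groverIters N g) x (s.image e) hG hw
  unfold groverProb
  rw [← this]
  refine sum_congr rfl fun b _ => if_congr ?_ rfl rfl
  simp only [mem_image]
  constructor
  · rintro ⟨j, hj, hg⟩
    exact ⟨e j, ⟨j, (hs j).2 hg, rfl⟩, hj⟩
  · rintro ⟨i, ⟨j, hj, rfl⟩, hi⟩
    exact ⟨j, hi, (hs j).1 hj⟩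

theorem expect_none_guessSearch {e : Fin N → I} (he : Function.Injective e)
    (good : Fin N → Fin q → Prop) (x : I → Fin q) (s : Finset (Fin N))
    (hs : ∀ j, j ∈ s ↔ good j (x (e j))) (gs : List ℕ) (c : ℕ) :
    QProg.expect x (fun o _ => if o = none then 1 else 0) c (guessSearch e good gs) =
      failProb N (#s) gs := by
  classical
  induction gs generalizing c with
  | nil => simp [guessSearch, QProg.expect, failProb]
  | cons g gs ih =>
    simp only [guessSearch, QProg.expect, failProb]
    have hP := guessCircuit_success he good g x s hs
    have h1 := (guessCircuit e good g).sum_outcomeProb x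
    have h2 : 1 - groverProb N (#s) g = ∑ b, ((guessCircuit e good g).outcomeProb x b -
        if ∃ j, b.1 = some (e j) ∧ good j (x (e j)) then
          (guessCircuit e good g).outcomeProb x b else 0) := by rw [sum_sub_distrib, hP, h1]
    rw [h2, sum_mul]
    refine sum_congr rfl fun b _ => ?_
    have := expect_checkPosition he good (guessSearch e good gs) b.1 x
      (fun o _ => if o = none then (1 : ℝ) else 0) (c + (guessCircuit e good g).T)
    by_cases H : ∃ j, b.1 = some (e j) ∧ good j (x (e j))
    · rw [if_pos H] at this ⊢
      obtain ⟨j, hj⟩ := this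
      rw [hj]; simp
    · rw [if_neg H] at this ⊢
      rw [ih, ih, or_self] at this
      rw [this]; ring

theorem expQueries_guessSearch {e : Fin N → I} (he : Function.Injective e)
    (good : Fin N → Fin q → Prop) (x : I → Fin q) (s : Finset (Fin N))
    (hs : ∀ j, j ∈ s ↔ good j (x (e j))) (gs : List ℕ) :
    (guessSearch e good gs).expQueries x ≤ expCost N (#s) gs := by
  classical
  induction gs with
  | nil => simp [guessSearch, QProg.expQueries, QProg.expect, expCost]
  | cons g gs ih =>
    simp only [guessSearch, QProg.expQueries, QProg.expect, expCost, zero_add]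
    have hP := guessCircuit_success he good g x s hs
    have h1 := (guessCircuit e good g).sum_outcomeProb x
    have hT : ((guessCircuit e good g).T : ℝ) = 2 * groverIters N g := by
      simp [guessCircuit, groverCircuit]
    -- A branch that measures a good position pays for the current guess only; any other branch also
    -- pays for the remaining list.
    have hb : ∀ b, (guessCircuit e good g).outcomeProb x b * QProg.expect x (fun _ c => (c : ℝ))
        (guessCircuit e good g).T (checkPosition e good (guessSearch e good gs) b.1) ≤
        (guessCircuit e good g).outcomeProb x b * guessCost N g +
        ((guessCircuit e good g).outcomeProb x b -
          if ∃ j, b.1 = some (e j) ∧ good j (x (e j)) then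
            (guessCircuit e good g).outcomeProb x b else 0) * expCost N (#s) gs := by
      intro b
      have h0 := (guessCircuit e good g).outcomeProb_nonneg x b
      have := expect_checkPosition he good (guessSearch e good gs) b.1 x
        (fun _ c => (c : ℝ)) (guessCircuit e good g).T
      unfold guessCost
      by_cases H : ∃ j, b.1 = some (e j) ∧ good j (x (e j))
      · rw [if_pos H] at this ⊢
        obtain ⟨j, hj⟩ := this
        rw [hj, Nat.cast_add, hT]; simp
      · rw [if_neg H] at this ⊢
        rw [sub_zero, ← mul_add]
        refine mul_le_mul_of_nonneg_left ?_ h0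
        rcases this with h | h <;> rw [h, QProg.expect_queries] <;> push_cast <;> rw [hT] <;>
          linarith
    refine (sum_le_sum fun b _ => hb b).trans ?_
    rw [sum_add_distrib, ← sum_mul, ← sum_mul, sum_sub_distrib, hP, h1, one_mul]

theorem surely_guessSearch (e : Fin N → I) (good : Fin N → Fin q → Prop) (x : I → Fin q) (gs : List ℕ) :
    (guessSearch e good gs).Surely x fun o => ∀ j, o = some j → good j (x (e j)) := by
  induction gs with
  | nil => simp [guessSearch, QProg.Surely]
  | cons g gs ih =>
    intro b
    change QProg.Surely x _ (checkPosition e good (guessSearch e good gs) b.1)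
    unfold checkPosition
    split
    · exact ih
    · simp only [QProg.Surely]
      split_ifs with h
      · simpa [QProg.Surely] using h
      · exact ih

end Guesses

/-! ## The list of guesses and its cost -/

section Ladder

open Finset

/-- The condition `g ≤ 4 * N` gives `√(N / g) ≥ 1 / 2`, which absorbs the rounding in the number of
iterations and the check query: `2 * √(N / g) + 3 ≤ 8 * √(N / g)`. -/
theorem guessCost_le {N g : ℕ} (hg : 1 ≤ g) (hgN : g ≤ 4 * N) :
    guessCost N g ≤ 8 * √((N : ℝ) / g) := by
  have hg' : (0 : ℝ) < g := by positivity
  have h1 : (groverIters N g : ℝ) < √((N : ℝ) / g) + 1 := Nat.ceil_lt_add_one (Real.sqrt_nonneg _)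
  have h2 : 1 / 2 ≤ √((N : ℝ) / g) := by
    apply Real.le_sqrt_of_sq_le
    rw [le_div_iff₀ hg']
    have : (g : ℝ) ≤ 4 * N := by exact_mod_cast hgN
    linarith
  unfold guessCost
  linarith

theorem guessCost_nonneg (N g : ℕ) : 0 ≤ guessCost N g := by unfold guessCost; positivity

theorem worstCost_append (N : ℕ) (gs hs : List ℕ) :
    worstCost N (gs ++ hs) = worstCost N gs + worstCost N hs := by
  induction gs with
  | nil => simp [worstCost]
  | cons g gs ih => simp [worstCost, ih, add_assoc]

theorem worstCost_replicate (N r g : ℕ) :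
    worstCost N (List.replicate r g) = r * guessCost N g := by
  induction r with
  | zero => simp [worstCost]
  | succ r ih => simp [List.replicate_succ, worstCost, ih]; ring

theorem expCost_append (N t : ℕ) (gs hs : List ℕ) :
    expCost N t (gs ++ hs) = expCost N t gs + failProb N t gs * expCost N t hs := by
  induction gs with
  | nil => simp [expCost, failProb]
  | cons g gs ih => simp only [List.cons_append, expCost, ih, failProb]; ring

theorem failProb_append (N t : ℕ) (gs hs : List ℕ) :
    failProb N t (gs ++ hs) = failProb N t gs * failProb N t hs := by
  induction gs with
  | nil => simp [failProb]
  | cons g gs ih => simp only [List.cons_append, failProb, ih]; ring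

theorem failProb_replicate (N t r g : ℕ) :
    failProb N t (List.replicate r g) = (1 - groverProb N t g) ^ r := by
  induction r with
  | zero => simp [failProb]
  | succ r ih => simp [List.replicate_succ, failProb, ih]; ring

theorem failProb_nonneg (N t : ℕ) (gs : List ℕ) : 0 ≤ failProb N t gs := by
  induction gs with
  | nil => simp [failProb]
  | cons g gs ih => exact mul_nonneg (by linarith [groverProb_le_one N t g]) ih

theorem failProb_le_one (N t : ℕ) (gs : List ℕ) : failProb N t gs ≤ 1 := by
  induction gs with
  | nil => simp [failProb]
  | cons g gs ih =>
    exact mul_le_one₀ (by linarith [groverProb_nonneg N t g]) (failProb_nonneg N t gs) ih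

theorem expCost_nonneg (N t : ℕ) (gs : List ℕ) : 0 ≤ expCost N t gs := by
  induction gs with
  | nil => simp [expCost]
  | cons g gs ih =>
    exact add_nonneg (guessCost_nonneg N g)
      (mul_nonneg (by linarith [groverProb_le_one N t g]) ih)

theorem expCost_le_worstCost (N t : ℕ) (gs : List ℕ) : expCost N t gs ≤ worstCost N gs := by
  induction gs with
  | nil => simp [expCost, worstCost]
  | cons g gs ih =>
    simp only [expCost, worstCost]
    have := mul_le_of_le_one_left (expCost_nonneg N t gs)
      (show 1 - groverProb N t g ≤ 1 by linarith [groverProb_nonneg N t g])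
    linarith

/-- Repeating a guess `r` times takes at most `2 / (1 / r + p)` expected attempts, where `p` is
the success probability. -/
theorem expCost_replicate_mul_le (N t r g : ℕ) :
    expCost N t (List.replicate r g) * (1 + r * groverProb N t g) ≤ 2 * r * guessCost N g := by
  have h1 : expCost N t (List.replicate r g) ≤ r * guessCost N g := by
    rw [← worstCost_replicate]; exact expCost_le_worstCost _ _ _
  -- At most `1 / p` attempts are expected, whatever their maximal number `r`; `h1` is the trivial
  -- bound by `r` attempts, and the claim is `h1 + r * h2`.
  have h2 : expCost N t (List.replicate r g) * groverProb N t g ≤ guessCost N g := by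
    clear h1
    have h0 := groverProb_nonneg N t g
    have h0' := groverProb_le_one N t g
    induction r with
    | zero => simpa [expCost] using guessCost_nonneg N g
    | succ r ih =>
      simp only [List.replicate_succ, expCost]
      nlinarith
  have h3 : (0 : ℝ) ≤ r := by positivity
  nlinarith

/-- The guesses `r, r - 1, …, 1`. -/
def exactGuesses : ℕ → List ℕ
  | 0 => []
  | r + 1 => (r + 1) :: exactGuesses r

/-- The guesses `l * 4 ^ i, …, l * 4`, each `l` times, and then `l, l - 1, …, 1`. -/
def ladder (l : ℕ) : ℕ → List ℕ
  | 0 => exactGuesses l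
  | i + 1 => List.replicate l (l * 4 ^ (i + 1)) ++ ladder l i

theorem worstCost_exactGuesses {N r : ℕ} (h : r ≤ N) :
    worstCost N (exactGuesses r) ≤ 16 * √((N : ℝ) * r) := by
  induction r with
  | zero => simp [exactGuesses, worstCost]
  | succ r ih =>
    have h1 := guessCost_le (N := N) (g := r + 1) (by omega) (by omega)
    have h2 := ih (by omega)
    simp only [exactGuesses, worstCost]
    rw [Real.sqrt_div (by positivity)] at h1
    rw [Real.sqrt_mul (by positivity)] at h2 ⊢
    have hr : (0 : ℝ) < √((r + 1 : ℕ) : ℝ) := by positivity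
    have hs := Real.sq_sqrt (show (0 : ℝ) ≤ ((r + 1 : ℕ) : ℝ) by positivity)
    have hs' := Real.sq_sqrt (show (0 : ℝ) ≤ (r : ℝ) by positivity)
    push_cast at hs hr h1 ⊢
    -- Comparison of `∑ 1 / √g` with `2 * √r`, in telescoping form.
    have h3 : 1 / √((r : ℝ) + 1) ≤ 2 * (√((r : ℝ) + 1) - √(r : ℝ)) := by
      rw [div_le_iff₀ hr]
      nlinarith [sq_nonneg (√((r : ℝ) + 1) - √(r : ℝ))]
    have h4 : √(N : ℝ) / √((r : ℝ) + 1) ≤ √(N : ℝ) * (2 * (√((r : ℝ) + 1) - √(r : ℝ))) := by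
      rw [div_eq_mul_one_div]; gcongr
    linarith

theorem sqrt_mul_four_pow (l i : ℕ) : √((l * 4 ^ i : ℕ) : ℝ) = √(l : ℝ) * 2 ^ i := by
  push_cast
  rw [Real.sqrt_mul (by positivity), show (4 : ℝ) ^ i = (2 ^ i) ^ 2 by
    rw [← pow_mul, mul_comm, pow_mul]; norm_num, Real.sqrt_sq (by positivity)]

theorem guessCost_level {N l i : ℕ} (hi : l * 4 ^ i ≤ 4 * N) :
    l * guessCost N (l * 4 ^ i) ≤ 8 * √((N : ℝ) * l) / 2 ^ i := by
  rcases Nat.eq_zero_or_pos l with rfl | hl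
  · simp
  have h1 := guessCost_le (N := N) (g := l * 4 ^ i) (Nat.mul_pos hl (by positivity)) hi
  rw [Real.sqrt_div (by positivity), sqrt_mul_four_pow] at h1
  have hs : √(l : ℝ) * √(l : ℝ) = l := Real.mul_self_sqrt (by positivity)
  have hl' : √(l : ℝ) ≠ 0 := by positivity
  calc l * guessCost N (l * 4 ^ i) ≤ l * (8 * (√(N : ℝ) / (√(l : ℝ) * 2 ^ i))) := by gcongr
    _ = _ := by
      rw [Real.sqrt_mul (by positivity)]
      nth_rewrite 1 [← hs]
      field_simp

theorem worstCost_ladder {N l i : ℕ} (hl : l ≤ N) (hi : l * 4 ^ i ≤ 4 * N) :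
    worstCost N (ladder l i) ≤ 8 * √((N : ℝ) * l) * (3 - 1 / 2 ^ i) := by
  induction i with
  | zero =>
    have := worstCost_exactGuesses hl
    simp only [ladder, pow_zero]
    linarith
  | succ i ih =>
    have h1 := ih (le_trans (Nat.mul_le_mul_left l (Nat.pow_le_pow_right (by norm_num)
      (Nat.le_succ i))) hi)
    have h2 := guessCost_level hi
    simp only [ladder, worstCost_append, worstCost_replicate]
    have h3 : 8 * √((N : ℝ) * l) / 2 ^ (i + 1) =
        8 * √((N : ℝ) * l) * (1 / 2 ^ i - 1 / 2 ^ (i + 1)) := by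
      rw [pow_succ]; field_simp; ring
    linarith

theorem worstCost_ladder_le {N l i : ℕ} (hl : l ≤ N) (hi : l * 4 ^ i ≤ 4 * N) :
    worstCost N (ladder l i) ≤ 24 * √((N : ℝ) * l) := by
  have h1 := worstCost_ladder hl hi
  have h2 : 0 ≤ √((N : ℝ) * l) * (1 / 2 ^ i) := by positivity
  nlinarith

/-- At `s = 2 ^ i` the left side is the shape of the expected cost of one level. The differences on
the right telescope over `i`, and since `s / (s + c) ≤ 1` the whole sum is `O(1 / c)` however many
levels there are. -/
theorem dyadic_telescope {s c : ℝ} (hs : 0 < s) (hc : 0 < c) :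
    2 * s / (4 * s ^ 2 + c ^ 2) ≤ 7 / 2 / c * (2 * s / (2 * s + c) - s / (s + c)) := by
  have e : 2 * s / (2 * s + c) - s / (s + c) = s * c / ((2 * s + c) * (s + c)) := by
    field_simp; ring
  rw [e, div_mul_div_comm, div_le_div_iff₀ (by positivity) (by positivity)]
  have h : 0 ≤ s * c * (10 * s ^ 2 + 3 / 2 * c ^ 2 - 6 * s * c) := by
    have : 0 ≤ 10 * s ^ 2 + 3 / 2 * c ^ 2 - 6 * s * c := by nlinarith [sq_nonneg (3 * s - c)]
    positivity
  nlinarith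

/-- Expected cost of one level, for a guess that is not too small. -/
theorem expCost_level {N l t i : ℕ} (ht : 1 ≤ t) (htl : t ≤ l * 4 ^ (i + 1))
    (hi : l * 4 ^ (i + 1) ≤ 4 * N) :
    expCost N t (List.replicate l (l * 4 ^ (i + 1))) ≤ 112 * (√((N : ℝ) * l) / √t) *
      ((2 ^ (i + 1)) / (2 ^ (i + 1) + √t / 2) - (2 ^ i) / (2 ^ i + √t / 2)) := by
  have hl : 0 < l := Nat.pos_of_ne_zero (by rintro rfl; omega)
  have hl' : (0 : ℝ) < l := by positivity
  have hp := le_groverProb (N := N) (ht.trans htl) htl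
  have h1 := expCost_replicate_mul_le N t l (l * 4 ^ (i + 1))
  have h2 := guessCost_level hi
  set E := expCost N t (List.replicate l (l * 4 ^ (i + 1)))
  have hE : 0 ≤ E := expCost_nonneg _ _ _
  set s : ℝ := 2 ^ i with hs
  have hs0 : 0 < s := by positivity
  have h4 : ((l * 4 ^ (i + 1) : ℕ) : ℝ) = l * (4 * s ^ 2) := by
    push_cast
    rw [hs, ← pow_mul, mul_comm i 2, pow_mul, pow_succ, mul_comm (4 ^ i) (4 : ℝ)]; norm_num
  have h2s : (2 : ℝ) ^ (i + 1) = 2 * s := by rw [hs]; ring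
  rw [h4] at hp
  rw [h2s] at h2 ⊢
  have hc0 : 0 < √(t : ℝ) := by positivity
  set c := √(t : ℝ) with hc
  have hc2 : c ^ 2 = t := Real.sq_sqrt (by positivity)
  -- Here `4 * s ^ 2 = 4 ^ (i + 1)`, and `2 / 5` is weakened to `1 / 4` so that the bound is a
  -- square.
  have h5 : (c / 2) ^ 2 / (4 * s ^ 2) ≤ l * groverProb N t (l * 4 ^ (i + 1)) := by
    calc (c / 2) ^ 2 / (4 * s ^ 2) ≤ l * (2 / 5 * (t / (l * (4 * s ^ 2)))) := by
          rw [div_pow, hc2]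
          have : (l : ℝ) * (2 / 5 * (t / (l * (4 * s ^ 2)))) = (2 / 5 * t) / (4 * s ^ 2) := by
            field_simp
          rw [this]
          gcongr
          have : (0 : ℝ) ≤ t := by positivity
          linarith
      _ ≤ _ := by gcongr
  have h6 : E * ((4 * s ^ 2 + (c / 2) ^ 2) / (4 * s ^ 2)) ≤ 16 * √((N : ℝ) * l) / (2 * s) := by
    calc E * ((4 * s ^ 2 + (c / 2) ^ 2) / (4 * s ^ 2))
        = E * (1 + (c / 2) ^ 2 / (4 * s ^ 2)) := by field_simp
      _ ≤ E * (1 + l * groverProb N t (l * 4 ^ (i + 1))) := by gcongr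
      _ ≤ 2 * (8 * √((N : ℝ) * l) / (2 * s)) := by linarith
      _ = _ := by ring
  have h7 : E ≤ 16 * √((N : ℝ) * l) * (2 * s / (4 * s ^ 2 + (c / 2) ^ 2)) := by
    rw [← le_div_iff₀ (by positivity)] at h6
    refine h6.trans (le_of_eq ?_)
    field_simp
    ring
  have h8 := dyadic_telescope hs0 (half_pos hc0)
  -- The constant is `112 = 16 * (7 / 2) * 2`, the last factor coming from `c / 2` in the
  -- denominator.
  calc E ≤ 16 * √((N : ℝ) * l) * (2 * s / (4 * s ^ 2 + (c / 2) ^ 2)) := h7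
    _ ≤ 16 * √((N : ℝ) * l) * (7 / 2 / (c / 2) *
        (2 * s / (2 * s + c / 2) - s / (s + c / 2))) := by gcongr
    _ = _ := by field_simp; ring

/-- Once a level with a suitable guess fails with probability at most `10 / √t`, the expected
cost of this level and the levels above is small. -/
theorem expCost_ladder {N l t b i : ℕ} (ht : 1 ≤ t) (htl : t ≤ l * 4 ^ (b + 1)) (hl : l ≤ N)
    (hfail : (1 - groverProb N t (l * 4 ^ (b + 1))) ^ l ≤ 10 / √t) (hbi : b ≤ i)
    (hi : l * 4 ^ (i + 1) ≤ 4 * N) :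
    expCost N t (ladder l (i + 1)) ≤ 240 * (√((N : ℝ) * l) / √t) + 112 * (√((N : ℝ) * l) / √t) *
      ((2 ^ (i + 1)) / (2 ^ (i + 1) + √t / 2)) := by
  induction i, hbi using Nat.le_induction with
  | base =>
    have h1 := expCost_level ht htl hi
    have hb : l * 4 ^ b ≤ 4 * N := le_trans (Nat.mul_le_mul_left l
      (Nat.pow_le_pow_right (by norm_num) (Nat.le_succ b))) hi
    have h2 := (expCost_le_worstCost N t (ladder l b)).trans (worstCost_ladder_le hl hb)
    simp only [ladder, expCost_append, failProb_replicate]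
    -- Everything below the reliable level is charged at its worst case, but is reached only if all
    -- `l` attempts there fail; `240 = 10 * 24`.
    have h3 : (1 - groverProb N t (l * 4 ^ (b + 1))) ^ l * expCost N t (ladder l b) ≤
        10 / √t * (24 * √((N : ℝ) * l)) :=
      mul_le_mul hfail h2 (expCost_nonneg _ _ _) (by positivity)
    have h4 : 0 ≤ 112 * (√((N : ℝ) * l) / √t) * ((2 ^ b) / (2 ^ b + √t / 2)) := by positivity
    have h5 : 10 / √t * (24 * √((N : ℝ) * l)) = 240 * (√((N : ℝ) * l) / √t) := by ring
    linarith
  | succ i hbi ih =>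
    have hle : l * 4 ^ (i + 1) ≤ l * 4 ^ (i + 1 + 1) :=
      Nat.mul_le_mul_left l (Nat.pow_le_pow_right (by norm_num) (Nat.le_succ _))
    have h0 := ih (hle.trans hi)
    have h1 := expCost_level ht (htl.trans (Nat.mul_le_mul_left l
      (Nat.pow_le_pow_right (by norm_num) (by omega)))) hi
    rw [ladder, expCost_append]
    have h2 := mul_le_of_le_one_left (expCost_nonneg N t (ladder l (i + 1)))
      (failProb_le_one N t (List.replicate l (l * 4 ^ (i + 1 + 1))))
    linarith

theorem one_sub_pow_le_exp {p : ℝ} (hp : p ≤ 1) (l : ℕ) : (1 - p) ^ l ≤ Real.exp (-(l * p)) := by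
  calc (1 - p) ^ l ≤ Real.exp (-p) ^ l :=
        pow_le_pow_left₀ (by linarith) (Real.one_sub_le_exp_neg p) l
    _ = _ := by rw [← Real.exp_nat_mul]; ring_nf

theorem failProb_exactGuesses {N r t : ℕ} (ht : 1 ≤ t) (htr : t ≤ r) :
    failProb N t (exactGuesses r) = 0 := by
  induction r with
  | zero => omega
  | succ r ih =>
    simp only [exactGuesses, failProb]
    rcases Nat.lt_or_ge r t with h | h
    · obtain rfl : t = r + 1 := by omega
      rw [groverProb_self ht]; ring
    · rw [ih h]; ring

theorem failProb_ladder {l : ℕ} (N t i : ℕ) (ht : 1 ≤ t) (htl : t ≤ l) :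
    failProb N t (ladder l i) = 0 := by
  induction i with
  | zero => exact failProb_exactGuesses ht htl
  | succ i ih => rw [ladder, failProb_append, ih, mul_zero]

theorem failProb_ladder_le {N l t b i : ℕ} (hbi : b ≤ i) :
    failProb N t (ladder l (i + 1)) ≤ (1 - groverProb N t (l * 4 ^ (b + 1))) ^ l := by
  induction i, hbi using Nat.le_induction with
  | base =>
    rw [ladder, failProb_append, failProb_replicate]
    exact mul_le_of_le_one_right
      (pow_nonneg (by linarith [groverProb_le_one N t (l * 4 ^ (b + 1))]) _) (failProb_le_one _ _ _)
  | succ i hbi ih =>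
    rw [ladder, failProb_append]
    exact (mul_le_of_le_one_left (failProb_nonneg _ _ _) (failProb_le_one _ _ _)).trans ih

/-! ### Choice of the repetition number and of the ladder -/

/-- Number of repetitions of each guess, for graphs with `n` vertices. -/
noncomputable def reps (n N : ℕ) : ℕ := min ⌈60 * Real.log n⌉₊ N

/-- The list of guesses for rows with `N` entries. -/
noncomputable def guesses (n N : ℕ) : List ℕ :=
  ladder (reps n N) (Nat.log 4 (N / reps n N) + 1)

theorem reps_le (n N : ℕ) : reps n N ≤ N := min_le_right _ _

theorem reps_le_log (n N : ℕ) : (reps n N : ℝ) ≤ 64 * Real.log n := by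
  have h : (reps n N : ℝ) ≤ ⌈60 * Real.log n⌉₊ := by exact_mod_cast min_le_left _ _
  rcases Nat.lt_or_ge n 2 with hn | hn
  · have : Real.log n = 0 := by interval_cases n <;> simp
    simpa [this] using h
  · have h2 : Real.log 2 ≤ Real.log n := Real.log_le_log (by norm_num) (by exact_mod_cast hn)
    have h3 := Real.log_two_gt_d9
    have h4 := Nat.ceil_lt_add_one (show 0 ≤ 60 * Real.log n by linarith)
    linarith

theorem reps_mul_four_pow_le (n N : ℕ) :
    reps n N * 4 ^ (Nat.log 4 (N / reps n N) + 1) ≤ 4 * N := by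
  rcases Nat.eq_zero_or_pos (reps n N) with h | h
  · simp [h]
  have h1 : N / reps n N ≠ 0 := (Nat.div_pos (reps_le n N) h).ne'
  have h2 := Nat.pow_log_le_self 4 h1
  calc reps n N * 4 ^ (Nat.log 4 (N / reps n N) + 1)
      = 4 * (reps n N * 4 ^ Nat.log 4 (N / reps n N)) := by ring
    _ ≤ 4 * (reps n N * (N / reps n N)) := by gcongr
    _ ≤ 4 * N := by gcongr; exact Nat.mul_div_le _ _

theorem lt_reps_mul_four_pow {n N : ℕ} (h : 0 < reps n N) :
    N < reps n N * 4 ^ (Nat.log 4 (N / reps n N) + 1) := by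
  have := Nat.lt_pow_succ_log_self (b := 4) (by norm_num) (N / reps n N)
  rw [mul_comm]
  exact (Nat.div_lt_iff_lt_mul h).1 this

theorem worstCost_guesses (n N : ℕ) : worstCost N (guesses n N) ≤ 24 * √((N : ℝ) * reps n N) :=
  worstCost_ladder_le (reps_le n N) (reps_mul_four_pow_le n N)

theorem reps_pos {n N : ℕ} (hn : 2 ≤ n) (hN : 1 ≤ N) : 0 < reps n N := by
  refine lt_min (Nat.ceil_pos.2 ?_) hN
  have := Real.log_pos (show (1 : ℝ) < n by exact_mod_cast hn)
  positivity

/-- A level at which all but a small probability of failure is used up. -/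
theorem exists_level {n N t : ℕ} (hn : 2 ≤ n) (hNn : N ≤ n) (ht : 1 ≤ t) (htN : t ≤ N) :
    ∃ b ≤ Nat.log 4 (N / reps n N), t ≤ reps n N * 4 ^ (b + 1) ∧
      (1 - groverProb N t (reps n N * 4 ^ (b + 1))) ^ reps n N ≤ 10 / √t ∧
      (t ≤ reps n N ∨
        (1 - groverProb N t (reps n N * 4 ^ (b + 1))) ^ reps n N ≤ 1 / (20 * n)) := by
  have hl := reps_pos hn (ht.trans htN)
  have hM := lt_reps_mul_four_pow hl
  have ht' : (1 : ℝ) ≤ t := by exact_mod_cast ht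
  have hst : √(t : ℝ) ≤ t := by
    rw [Real.sqrt_le_left (by positivity)]; nlinarith
  have hst0 : 0 < √(t : ℝ) := by positivity
  rcases Nat.lt_or_ge (reps n N) t with h | h
  -- As `t ≤ N`, the minimum in `reps` is the logarithmic term in this case.
  · have hL : reps n N = ⌈60 * Real.log n⌉₊ := by
      unfold reps at h ⊢
      exact min_eq_left (by omega)
    set l := reps n N
    have hex : ∃ b, t ≤ l * 4 ^ (b + 1) := ⟨_, (htN.trans hM.le)⟩
    classical
    have hb := Nat.find_spec hex
    have hbM : Nat.find hex ≤ Nat.log 4 (N / l) := Nat.find_min' hex (htN.trans hM.le)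
    set b := Nat.find hex with hbdef
    -- Minimality of `b` bounds the guess by `4 * t`; for `b = 0` this is `l < t`.
    have h4 : l * 4 ^ (b + 1) ≤ 4 * t := by
      rcases Nat.eq_zero_or_pos b with h0 | h0
      · rw [h0]; omega
      · have := Nat.find_min hex (show b - 1 < Nat.find hex by omega)
        rw [Nat.sub_add_cancel h0] at this
        have e4 : l * 4 ^ (b + 1) = 4 * (l * 4 ^ b) := by ring
        omega
    have hp : 1 / 10 ≤ groverProb N t (l * 4 ^ (b + 1)) := by
      refine le_trans ?_ (le_groverProb (ht.trans hb) hb)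
      have h5 : ((l * 4 ^ (b + 1) : ℕ) : ℝ) ≤ 4 * t := by exact_mod_cast h4
      have h6 : (0 : ℝ) < ((l * 4 ^ (b + 1) : ℕ) : ℝ) := by
        exact_mod_cast lt_of_lt_of_le ht hb
      have : 1 / 4 ≤ (t : ℝ) / ((l * 4 ^ (b + 1) : ℕ) : ℝ) := by
        rw [le_div_iff₀ h6]; linarith
      linarith
    have hn' : (2 : ℝ) ≤ n := by exact_mod_cast hn
    -- The success probability is at least `1 / 10` and `l ≥ 60 * log n`, so the exponent is at
    -- least `6 * log n`; as `n ≥ 2`, this is more than both required bounds need.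
    have hfail : (1 - groverProb N t (l * 4 ^ (b + 1))) ^ l ≤ 1 / (n : ℝ) ^ 6 := by
      refine (one_sub_pow_le_exp (groverProb_le_one _ _ _) l).trans ?_
      have h7 : 60 * Real.log n ≤ l := by rw [hL]; exact Nat.le_ceil _
      have h8 : 6 * Real.log n ≤ l * groverProb N t (l * 4 ^ (b + 1)) := by
        have : (0 : ℝ) ≤ l := by positivity
        nlinarith
      calc Real.exp (-(l * groverProb N t (l * 4 ^ (b + 1))))
          ≤ Real.exp (-(6 * Real.log n)) := Real.exp_le_exp.2 (by linarith)
        _ = 1 / (n : ℝ) ^ 6 := by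
          rw [Real.exp_neg, one_div, show (6 : ℝ) * Real.log n = (6 : ℕ) * Real.log n by norm_num,
            Real.exp_nat_mul, Real.exp_log (by linarith)]
    have hn5 : (32 : ℝ) ≤ (n : ℝ) ^ 5 := by
      calc (32 : ℝ) = 2 ^ 5 := by norm_num
        _ ≤ _ := by gcongr
    have hn6 : 32 * (n : ℝ) ≤ (n : ℝ) ^ 6 := by
      rw [show (n : ℝ) ^ 6 = (n : ℝ) ^ 5 * n by ring]; gcongr
    refine ⟨b, hbM, hb, hfail.trans ?_, Or.inr (hfail.trans ?_)⟩
    · rw [div_le_div_iff₀ (by positivity) hst0]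
      have : (t : ℝ) ≤ n := by exact_mod_cast htN.trans hNn
      linarith
    · apply one_div_le_one_div_of_le (by positivity)
      linarith
  -- For `t ≤ l` the lowest repeated level, with guess `4 * l`, fails with probability at most `exp
  -- (-t / 10)`. This suffices for the expected cost; reliability comes from the exact guess `t`
  -- further down the list.
  · refine ⟨0, Nat.zero_le _, by omega, ?_, Or.inl h⟩
    set l := reps n N
    have hp := le_groverProb (N := N) (t := t) (g := l * 4 ^ (0 + 1)) (by omega) (by omega)
    refine (one_sub_pow_le_exp (groverProb_le_one _ _ _) l).trans ?_
    have hl' : (0 : ℝ) < l := by exact_mod_cast hl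
    have h1 : (t : ℝ) / 10 ≤ l * groverProb N t (l * 4 ^ (0 + 1)) := by
      refine le_trans (le_of_eq ?_) (mul_le_mul_of_nonneg_left hp hl'.le)
      push_cast
      field_simp
      norm_num
    calc Real.exp (-(l * groverProb N t (l * 4 ^ (0 + 1))))
        ≤ Real.exp (-((t : ℝ) / 10)) := Real.exp_le_exp.2 (by linarith)
      _ ≤ 1 / ((t : ℝ) / 10) := by
        rw [Real.exp_neg, ← one_div]
        exact one_div_le_one_div_of_le (by positivity)
          (by linarith [Real.add_one_le_exp ((t : ℝ) / 10)])
      _ = 10 / t := by field_simp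
      _ ≤ 10 / √t := by gcongr

theorem expCost_guesses {n N t : ℕ} (hn : 2 ≤ n) (hNn : N ≤ n) (ht : 1 ≤ t) (htN : t ≤ N) :
    expCost N t (guesses n N) ≤ 352 * √((N : ℝ) * reps n N / t) := by
  obtain ⟨b, hb, htb, hf, -⟩ := exists_level hn hNn ht htN
  have h := expCost_ladder ht htb (reps_le n N) hf hb (reps_mul_four_pow_le n N)
  rw [Real.sqrt_div (by positivity)]
  have h1 : (2 : ℝ) ^ (Nat.log 4 (N / reps n N) + 1) /
      (2 ^ (Nat.log 4 (N / reps n N) + 1) + √t / 2) ≤ 1 := by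
    rw [div_le_one (by positivity)]
    linarith [Real.sqrt_nonneg (t : ℝ)]
  have h2 := mul_le_of_le_one_right
    (show 0 ≤ 112 * (√((N : ℝ) * reps n N) / √t) by positivity) h1
  unfold guesses
  linarith

theorem failProb_guesses {n N t : ℕ} (hn : 2 ≤ n) (hNn : N ≤ n) (ht : 1 ≤ t) (htN : t ≤ N) :
    failProb N t (guesses n N) ≤ 1 / (20 * n) := by
  obtain ⟨b, hb, -, -, h | h⟩ := exists_level hn hNn ht htN
  · rw [guesses, failProb_ladder N t _ ht h]; positivity
  · exact (failProb_ladder_le hb).trans h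

/-- For `n = 1` or an empty row the query bounds are `0`, so the search must not even make its check
query. -/
theorem guesses_eq_nil {n N : ℕ} (h : reps n N = 0) : guesses n N = [] := by
  simp [guesses, h, ladder, exactGuesses]

end Ladder

/-! ## Analysis of the depth-first search -/

section Search

open Finset

variable {n q : ℕ} {len : Fin n → ℕ}

/-- The directed graph given by the input `x` through the decoding `dec`. -/
def rowGraph (dec : (u : Fin n) → Fin (len u) → Fin q → Option (Fin n))
    (x : (u : Fin n) × Fin (len u) → Fin q) : Digraph (Fin n) where
  Adj u v := ∃ j, dec u j (x ⟨u, j⟩) = some v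

open Classical in
/-- The positions of row `u` that hold a neighbor outside `S`. -/
noncomputable def newPositions (dec : (u : Fin n) → Fin (len u) → Fin q → Option (Fin n))
    (x : (u : Fin n) × Fin (len u) → Fin q) (u : Fin n) (S : Finset (Fin n)) :
    Finset (Fin (len u)) :=
  univ.filter fun j => IsNewNeighbor dec x u S j

variable (dec : (u : Fin n) → Fin (len u) → Fin q → Option (Fin n))
  (x : (u : Fin n) × Fin (len u) → Fin q)

theorem mem_newPositions {u : Fin n} {S : Finset (Fin n)} {j : Fin (len u)} :
    j ∈ newPositions dec x u S ↔ IsNewNeighbor dec x u S j := by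
  simp [newPositions]

theorem card_newPositions_le (u : Fin n) (S : Finset (Fin n)) :
    #(newPositions dec x u S) ≤ len u := by
  simpa using card_le_univ (newPositions dec x u S)

theorem newPositions_nonempty {u v : Fin n} {S : Finset (Fin n)} (hv : v ∉ S)
    (h : (rowGraph dec x).Adj u v) : 1 ≤ #(newPositions dec x u S) := by
  obtain ⟨j, hj⟩ := h
  exact card_pos.2 ⟨j, (mem_newPositions dec x).2 ⟨v, hj, hv⟩⟩

theorem newPositions_insert_subset (u v : Fin n) (S : Finset (Fin n)) :
    newPositions dec x u (insert v S) ⊆ newPositions dec x u S := by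
  intro j hj
  obtain ⟨w, hw, hwS⟩ := (mem_newPositions dec x).1 hj
  exact (mem_newPositions dec x).2 ⟨w, hw, fun h => hwS (mem_insert_of_mem h)⟩

/-- Each child found at `u` strictly lowers the number of new positions, so the costs of the
successful searches at `u` involve distinct values of `t`. -/
theorem card_newPositions_insert_lt {u v : Fin n} {S : Finset (Fin n)} (hv : v ∉ S)
    (h : (rowGraph dec x).Adj u v) :
    #(newPositions dec x u (insert v S)) < #(newPositions dec x u S) := by
  obtain ⟨j, hj⟩ := h
  refine card_lt_card ((ssubset_iff_of_subset (newPositions_insert_subset dec x u v S)).2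
    ⟨j, (mem_newPositions dec x).2 ⟨v, hj, hv⟩, fun hj' => ?_⟩)
  obtain ⟨w, hw, hwS⟩ := (mem_newPositions dec x).1 hj'
  rw [hj, Option.some.injEq] at hw
  exact hwS (hw ▸ mem_insert_self v S)

theorem surely_findNeighbor (search : SearchFamily n q len) (u : Fin n) (S : Finset (Fin n)) :
    (findNeighbor dec search u S).Surely x
      fun r => ∀ v, r = some v → v ∉ S ∧ (rowGraph dec x).Adj u v := by
  refine QProg.surely_bind (QProg.surely_true x _) fun r _ => ?_
  cases r with
  | none => simp [QProg.Surely]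
  | some j =>
    simp only [QProg.Surely, Option.filter_eq_some_iff, decide_eq_true_eq]
    exact fun v hv => ⟨hv.2, j, hv.1⟩

theorem maxQueries_findNeighbor_le (search : SearchFamily n q len) (u : Fin n)
    (S : Finset (Fin n)) :
    (findNeighbor dec search u S).maxQueries ≤ (search u S).maxQueries + 1 := by
  refine QProg.maxQueries_bind_le _ _ fun r => ?_
  cases r with
  | none => simp [QProg.maxQueries]
  | some j =>
    simp only [QProg.maxQueries]
    have : (univ.sup fun _ : Fin q => 0) ≤ 0 := Finset.sup_le fun _ _ => le_rfl
    omega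

theorem expQueries_findNeighbor_le [NeZero q] (search : SearchFamily n q len) (u : Fin n)
    (S : Finset (Fin n)) :
    (findNeighbor dec search u S).expQueries x ≤ (search u S).expQueries x + 1 := by
  refine (QProg.expQueries_bind_le (r := 1) x _ (search u S) fun r => ?_).trans (by simp)
  cases r with
  | none => simp [QProg.maxQueries]
  | some j =>
    simp only [QProg.maxQueries]
    have : (univ.sup fun _ : Fin q => 0) ≤ 0 := Finset.sup_le fun _ _ => le_rfl
    omega

/-- The search for a new neighbor of `u` by repeated Grover searches. -/
noncomputable def groverSearch [NeZero q] : SearchFamily n q len := fun u S =>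
  guessSearch (fun j => ⟨u, j⟩) (fun j y => ∃ v, dec u j y = some v ∧ v ∉ S) (guesses n (len u))

variable [NeZero q]

theorem sqrt_mul_reps_le (N : ℕ) {a : ℝ} (ha : 0 ≤ a) :
    √(a * reps n N) ≤ 8 * √(a * Real.log n) := by
  rw [show (8 : ℝ) = √64 by rw [show (64 : ℝ) = 8 ^ 2 by norm_num]; simp,
    ← Real.sqrt_mul (by norm_num)]
  apply Real.sqrt_le_sqrt
  have := mul_le_mul_of_nonneg_left (reps_le_log n N) ha
  linarith

theorem maxQueries_groverSearch (u : Fin n) (S : Finset (Fin n)) :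
    ((groverSearch dec u S).maxQueries : ℝ) ≤ 192 * √(len u * Real.log n) := by
  have h1 := maxQueries_guessSearch (I := (u : Fin n) × Fin (len u)) (fun j => ⟨u, j⟩)
    (fun j (y : Fin q) => ∃ v, dec u j y = some v ∧ v ∉ S) (guesses n (len u))
  have h2 := worstCost_guesses n (len u)
  have h3 := sqrt_mul_reps_le (n := n) (len u) (show (0 : ℝ) ≤ len u by positivity)
  unfold groverSearch
  linarith

/-- Either nothing is searched and no query is made, or `len u * reps n (len u) ≥ 1`, which lets the
final check be absorbed: `200 = 8 * (24 + 1)`. -/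
theorem maxQueries_findNeighbor_groverSearch (u : Fin n) (S : Finset (Fin n)) :
    ((findNeighbor dec (groverSearch dec) u S).maxQueries : ℝ) ≤
      200 * √(len u * Real.log n) := by
  rcases Nat.eq_zero_or_pos (reps n (len u)) with h | h
  · simp [findNeighbor, groverSearch, guesses_eq_nil h, guessSearch, QProg.bind,
      QProg.maxQueries]
    positivity
  · have h0 : ((findNeighbor dec (groverSearch dec) u S).maxQueries : ℝ) ≤
        (groverSearch dec u S).maxQueries + 1 := by
      exact_mod_cast maxQueries_findNeighbor_le dec (groverSearch dec) u S
    have h1 := maxQueries_groverSearch dec u S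
    have h3 := sqrt_mul_reps_le (n := n) (len u) (show (0 : ℝ) ≤ len u by positivity)
    have h4 : (1 : ℝ) ≤ √(len u * reps n (len u)) := by
      rw [Real.one_le_sqrt]
      have : 1 ≤ len u * reps n (len u) := Nat.mul_pos (h.trans_le (reps_le _ _)) h
      exact_mod_cast this
    linarith

/-- Without a new neighbor the worst-case bound is used, which is what `max 1` encodes. Otherwise
the final check is absorbed as before, and `2824 = 8 * (352 + 1)`. -/
theorem expQueries_findNeighbor_groverSearch {u : Fin n} {S : Finset (Fin n)} (hu : len u ≤ n)
    (huS : u ∈ S) :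
    (findNeighbor dec (groverSearch dec) u S).expQueries x ≤
      2824 * √(Real.log n) * √(len u / (max 1 #(newPositions dec x u S) : ℕ)) := by
  rcases Nat.eq_zero_or_pos #(newPositions dec x u S) with h | h
  · have h1 := QProg.expQueries_le_maxQueries x (findNeighbor dec (groverSearch dec) u S)
    have h2 := maxQueries_findNeighbor_groverSearch dec u S
    rw [h]
    rw [Real.sqrt_mul (by positivity)] at h2
    simp only [zero_le, sup_of_le_left, Nat.cast_one, div_one]
    have : 0 ≤ √(len u : ℝ) * √(Real.log n) := by positivity
    nlinarith
  · set t := #(newPositions dec x u S) with ht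
    obtain ⟨j, hj⟩ := card_pos.1 h
    obtain ⟨v, -, hv⟩ := (mem_newPositions dec x).1 hj
    -- The vertex `u` lies in `S` and its new neighbor does not, so there are two vertices.
    have hn : 2 ≤ n := by
      have : u ≠ v := fun h => hv (h ▸ huS)
      have := Fin.val_ne_of_ne this
      omega
    have htN := card_newPositions_le dec x u S
    have h0 := expQueries_findNeighbor_le dec x (groverSearch dec) u S
    have h1 := expQueries_guessSearch (I := (u : Fin n) × Fin (len u)) (e := fun j => ⟨u, j⟩)
      (fun _ _ h => by simpa using h) (fun j (y : Fin q) => ∃ v, dec u j y = some v ∧ v ∉ S) x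
      (newPositions dec x u S) (fun j => mem_newPositions dec x) (guesses n (len u))
    have h2 := expCost_guesses hn hu h htN
    have hl := reps_pos hn (le_trans h htN)
    have h3 : 1 ≤ √((len u : ℝ) * reps n (len u) / t) := by
      rw [Real.one_le_sqrt, one_le_div (by exact_mod_cast h)]
      have : t ≤ len u * reps n (len u) := le_trans htN (Nat.le_mul_of_pos_right _ hl)
      exact_mod_cast this
    have h4 := sqrt_mul_reps_le (n := n) (len u) (show (0 : ℝ) ≤ len u / t by positivity)
    rw [Real.sqrt_mul (by positivity)] at h4
    rw [max_eq_right h, mul_assoc]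
    have h5 : (len u : ℝ) * reps n (len u) / t = len u / t * reps n (len u) := by ring
    rw [Real.sqrt_mul (by positivity), ← Real.sqrt_mul (by positivity), ← h5] at h4
    unfold groverSearch at h0 ⊢
    linarith

theorem expect_none_groverSearch {u : Fin n} {S : Finset (Fin n)} (hu : len u ≤ n)
    (huS : u ∈ S) (h : 1 ≤ #(newPositions dec x u S)) (c : ℕ) :
    QProg.expect x (fun r _ => if r = none then 1 else 0) c (groverSearch dec u S) ≤
      1 / (20 * (n : ℝ)) := by
  obtain ⟨j, hj⟩ := card_pos.1 h
  obtain ⟨v, -, hv⟩ := (mem_newPositions dec x).1 hj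
  have hn : 2 ≤ n := by
    have : u ≠ v := fun h => hv (h ▸ huS)
    have := Fin.val_ne_of_ne this
    omega
  refine le_trans (le_of_eq ?_) (failProb_guesses hn hu h (card_newPositions_le dec x u S))
  exact expect_none_guessSearch (I := (u : Fin n) × Fin (len u)) (e := fun j => ⟨u, j⟩)
      (fun _ _ h => by simpa using h) (fun j (y : Fin q) => ∃ v, dec u j y = some v ∧ v ∉ S) x
      (newPositions dec x u S) (fun j => mem_newPositions dec x) (guesses n (len u)) c

theorem surely_groverSearch (u : Fin n) (S : Finset (Fin n)) :
    (groverSearch dec u S).Surely x fun r => ∀ j, r = some j → IsNewNeighbor dec x u S j :=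
  surely_guessSearch (I := (u : Fin n) × Fin (len u)) (fun j => ⟨u, j⟩)
    (fun j (y : Fin q) => ∃ v, dec u j y = some v ∧ v ∉ S) x (guesses n (len u))

theorem expect_none_findNeighbor {u : Fin n} {S : Finset (Fin n)} (hu : len u ≤ n)
    (huS : u ∈ S) (h : 1 ≤ #(newPositions dec x u S)) (c : ℕ) :
    QProg.expect x (fun r _ => if r = none then 1 else 0) c
      (findNeighbor dec (groverSearch dec) u S) ≤ 1 / (20 * (n : ℝ)) := by
  refine le_trans (le_of_eq ?_) (expect_none_groverSearch dec x hu huS h c)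
  unfold findNeighbor
  rw [QProg.expect_bind]
  refine QProg.expect_congr (surely_groverSearch dec x u S) (fun r c hr => ?_) c
  cases r with
  | none => simp [QProg.expect]
  | some j =>
    obtain ⟨v, hv, hvS⟩ := hr j rfl
    simp [QProg.expect, hv, hvS]

theorem isNeighborSearch_groverSearch (X : Set ((u : Fin n) × Fin (len u) → Fin q)) {C : ℝ}
    (hC : 192 ≤ C) (hX : ∀ x ∈ X, ∀ u, len u ≤ n) :
    IsNeighborSearch dec X C (groverSearch dec) := by
  intro u S huS
  refine ⟨(maxQueries_groverSearch dec u S).trans (by gcongr), fun x hx ⟨j, hj⟩ => ?_⟩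
  have hcard : 1 ≤ #(newPositions dec x u S) :=
    card_pos.2 ⟨j, (mem_newPositions dec x).2 hj⟩
  have h1 := expect_none_groverSearch dec x (hX x hx u) huS hcard 0
  rw [QProg.prob_eq_expect x _ _ 0]
  -- Every output other than `none` has been verified, so the success probability is `1` minus the
  -- probability of `none`.
  have h2 : QProg.expect x (fun r _ => 1 + -1 * if r = none then (1 : ℝ) else 0) 0
      (groverSearch dec u S) ≤ QProg.expect x (fun a _ => Set.indicator
        {r | ∃ j, r = some j ∧ IsNewNeighbor dec x u S j} 1 a) 0 (groverSearch dec u S) := by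
    refine QProg.expect_mono (surely_groverSearch dec x u S) (fun r c hr => ?_) 0
    cases r with
    | none => simp
    | some j => simp [hr j rfl]
  rw [QProg.expect_add x (fun _ _ => 1), QProg.expect_const, QProg.expect_const_mul] at h2
  linarith

end Search

/-! ### Invariants and worst-case cost of the depth-first loop -/

section Loop

open Finset

variable {n q : ℕ} {len : Fin n → ℕ}

/-- Invariant of depth-first search in `G` from `v₀`. -/
structure DfsInvariant (G : Digraph (Fin n)) (v₀ : Fin n) (A : Finset (Fin n × Fin n))
    (S : Finset (Fin n)) (stack : List (Fin n)) : Prop where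
  root_mem : v₀ ∈ S
  edges : ∀ e ∈ A, G.Adj e.1 e.2
  tree : IsDirectedTree v₀ A
  ends : ∀ a b, (a, b) ∈ A → a ∈ S ∧ b ∈ S
  reach : ∀ v ∈ S, Reaches A v₀ v
  nodup : stack.Nodup
  subset : ∀ u ∈ stack, u ∈ S

theorem Reaches.mono {A A' : Finset (Fin n × Fin n)} (h : A ⊆ A') {u v : Fin n}
    (huv : Reaches A u v) : Reaches A' u v :=
  Relation.ReflTransGen.mono (fun _ _ hab => h hab) _ _ huv

theorem dfsInvariant_init (G : Digraph (Fin n)) (v₀ : Fin n) :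
    DfsInvariant G v₀ ∅ {v₀} [v₀] where
  root_mem := mem_singleton_self _
  edges := by simp
  tree := ⟨by simp, by simp, by simp⟩
  ends := by simp
  reach v hv := by rw [mem_singleton.1 hv]; exact Relation.ReflTransGen.refl
  nodup := by simp
  subset := by simp

namespace DfsInvariant

variable {G : Digraph (Fin n)} {v₀ u v : Fin n} {A : Finset (Fin n × Fin n)}
  {S : Finset (Fin n)} {rest : List (Fin n)}

theorem pop (h : DfsInvariant G v₀ A S (u :: rest)) : DfsInvariant G v₀ A S rest :=
  { h with
    nodup := (List.nodup_cons.1 h.nodup).2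
    subset := fun w hw => h.subset w (List.mem_cons_of_mem u hw) }

theorem push (h : DfsInvariant G v₀ A S (u :: rest)) (hv : v ∉ S) (huv : G.Adj u v) :
    DfsInvariant G v₀ (insert (u, v) A) (insert v S) (v :: u :: rest) := by
  have hu : u ∈ S := h.subset u List.mem_cons_self
  have hreach : ∀ w ∈ insert v S, Reaches (insert (u, v) A) v₀ w := by
    intro w hw
    rcases mem_insert.1 hw with rfl | hw
    · exact ((h.reach u hu).mono (subset_insert _ _)).tail (mem_insert_self _ _)
    · exact (h.reach w hw).mono (subset_insert _ _)
  have hends : ∀ a b, (a, b) ∈ insert (u, v) A → a ∈ insert v S ∧ b ∈ insert v S := by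
    intro a b hab
    rcases mem_insert.1 hab with hab | hab
    · obtain ⟨rfl, rfl⟩ := Prod.mk.inj hab
      exact ⟨mem_insert_of_mem hu, mem_insert_self _ _⟩
    · exact ⟨mem_insert_of_mem (h.ends a b hab).1, mem_insert_of_mem (h.ends a b hab).2⟩
  refine ⟨mem_insert_of_mem h.root_mem, ?_, ⟨?_, ?_, ?_⟩, hends, hreach, ?_, ?_⟩
  · intro e he
    rcases mem_insert.1 he with rfl | he
    · exact huv
    · exact h.edges e he
  · intro w hw
    rcases mem_insert.1 hw with hw | hw
    · exact hv ((Prod.mk.inj hw).2 ▸ h.root_mem)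
    · exact h.tree.root_no_in w hw
  · intro a a' b hab hab'
    rcases mem_insert.1 hab with hab | hab <;> rcases mem_insert.1 hab' with hab' | hab'
    · rw [(Prod.mk.inj hab).1, (Prod.mk.inj hab').1]
    · exact absurd ((Prod.mk.inj hab).2 ▸ (h.ends _ _ hab').2) hv
    · exact absurd ((Prod.mk.inj hab').2 ▸ (h.ends _ _ hab).2) hv
    · exact h.tree.in_unique a a' b hab hab'
  · exact fun a b hab => ⟨hreach a (hends a b hab).1, hreach b (hends a b hab).2⟩
  · exact List.nodup_cons.2 ⟨fun hmem => hv (h.subset v hmem), h.nodup⟩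
  · intro w hw
    rcases List.mem_cons.1 hw with rfl | hw
    · exact mem_insert_self _ _
    · exact mem_insert_of_mem (h.subset w hw)

theorem mem_treesIn {stack : List (Fin n)} (h : DfsInvariant G v₀ A S stack) :
    A ∈ treesIn G v₀ := ⟨h.edges, h.tree⟩

end DfsInvariant

variable (dec : (u : Fin n) → Fin (len u) → Fin q → Option (Fin n))
  (x : (u : Fin n) × Fin (len u) → Fin q) (search : SearchFamily n q len) (B : ℕ)

/-- This holds for every family of subroutines: the check query in `findNeighbor` rejects whatever
is not an edge to an unvisited vertex. -/
theorem prob_dfsLoop_treesIn [NeZero q] {v₀ : Fin n} (fuel used : ℕ)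
    {A : Finset (Fin n × Fin n)} {S : Finset (Fin n)} {stack : List (Fin n)}
    (h : DfsInvariant (rowGraph dec x) v₀ A S stack) :
    (dfsLoop dec search B fuel used A S stack).prob x (treesIn (rowGraph dec x) v₀) = 1 := by
  induction fuel generalizing used A S stack with
  | zero => simp [dfsLoop, QProg.prob, h.mem_treesIn]
  | succ fuel ih =>
    cases stack with
    | nil => simp [dfsLoop, QProg.prob, h.mem_treesIn]
    | cons u rest =>
      rw [dfsLoop]
      split_ifs with hB
      · simp [QProg.prob, h.mem_treesIn]
      · rw [QProg.prob_counted_bind]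
        refine (QProg.expect_congr (surely_findNeighbor dec x search u S) (h' := fun _ _ => 1)
          (fun r c hr => ?_) used).trans (QProg.expect_const x 1 _ _)
        cases r with
        | none => exact ih c h.pop
        | some v => exact ih c (h.push (hr v rfl).1 (hr v rfl).2)

/-- A round begins only if at most `B` queries have been made, so the cutoff is exceeded by at most
one search. -/
theorem maxQueries_dfsLoop [NeZero q] {R : ℕ}
    (hR : ∀ u S, (findNeighbor dec search u S).maxQueries ≤ R) (fuel used : ℕ)
    (A : Finset (Fin n × Fin n)) (S : Finset (Fin n)) (stack : List (Fin n))
    (hused : used ≤ B + R) :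
    used + (dfsLoop dec search B fuel used A S stack).maxQueries ≤ B + R := by
  induction fuel generalizing used A S stack with
  | zero => simpa [dfsLoop, QProg.maxQueries]
  | succ fuel ih =>
    cases stack with
    | nil => simpa [dfsLoop, QProg.maxQueries]
    | cons u rest =>
      rw [dfsLoop]
      split_ifs with hB
      · simpa [QProg.maxQueries]
      · refine QProg.add_maxQueries_counted_bind_le _ _ _ fun r c hc => ?_
        have hc' : c ≤ B + R := by have := hR u S; omega
        cases r with
        | none => exact ih c A S rest hc'
        | some v => exact ih c _ _ _ hc'

/-- A set that contains the root and is closed under out-neighbors contains every vertex on a path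
in any given spanning tree. -/
theorem mem_spanningTreesIn {v₀ : Fin n} {A : Finset (Fin n × Fin n)} {S : Finset (Fin n)}
    {stack : List (Fin n)} (h : DfsInvariant (rowGraph dec x) v₀ A S stack)
    (hclosed : ∀ u ∈ S, ∀ j, ¬ IsNewNeighbor dec x u S j)
    (hG : (spanningTreesIn (rowGraph dec x) v₀).Nonempty) :
    A ∈ spanningTreesIn (rowGraph dec x) v₀ := by
  refine ⟨h.mem_treesIn, fun v => h.reach v ?_⟩
  obtain ⟨T, ⟨hT, -⟩, hreach⟩ := hG
  induction hreach v with
  | refl => exact h.root_mem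
  | tail _ hbc ih =>
    obtain ⟨j, hj⟩ := hT _ hbc
    by_contra hc
    exact hclosed _ ih j ⟨_, hj, hc⟩

/-! ### The potential for the total expected cost -/

/-- The part of `√N` that exceeds `μ √t`. -/
noncomputable def sqrtExcess (N : ℕ) (μ : ℝ) (t : ℕ) : ℝ := max 0 (√N - μ * √t)

theorem sqrtExcess_nonneg (N : ℕ) (μ : ℝ) (t : ℕ) : 0 ≤ sqrtExcess N μ t := le_max_left _ _

theorem sqrtExcess_antitone (N : ℕ) {μ : ℝ} (hμ : 0 ≤ μ) {s t : ℕ} (h : s ≤ t) :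
    sqrtExcess N μ t ≤ sqrtExcess N μ s := by
  unfold sqrtExcess
  gcongr

theorem sqrtExcess_sq_le (N : ℕ) {μ : ℝ} (hμ : 0 ≤ μ) (t : ℕ) : sqrtExcess N μ t ^ 2 ≤ N := by
  have h : sqrtExcess N μ t ≤ √N :=
    max_le (Real.sqrt_nonneg _) (by have : 0 ≤ μ * √t := by positivity
                                    linarith)
  calc sqrtExcess N μ t ^ 2 ≤ √N ^ 2 := pow_le_pow_left₀ (sqrtExcess_nonneg N μ t) h 2
    _ = N := Real.sq_sqrt (by positivity)

/-- Bound for the cost of finding `t` neighbors in a row of length `N`, beyond `μ` for each. -/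
noncomputable def rowPotential (N : ℕ) (μ : ℝ) (t : ℕ) : ℝ := (N - sqrtExcess N μ t ^ 2) / μ

theorem rowPotential_nonneg (N : ℕ) {μ : ℝ} (hμ : 0 ≤ μ) (t : ℕ) : 0 ≤ rowPotential N μ t :=
  div_nonneg (sub_nonneg.2 (sqrtExcess_sq_le N hμ t)) hμ

theorem rowPotential_le (N : ℕ) {μ : ℝ} (hμ : 0 ≤ μ) (t : ℕ) : rowPotential N μ t ≤ N / μ := by
  unfold rowPotential
  gcongr
  linarith [sq_nonneg (sqrtExcess N μ t)]

theorem rowPotential_mono (N : ℕ) {μ : ℝ} (hμ : 0 ≤ μ) {s t : ℕ} (h : s ≤ t) :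
    rowPotential N μ s ≤ rowPotential N μ t := by
  unfold rowPotential
  have := pow_le_pow_left₀ (sqrtExcess_nonneg N μ t) (sqrtExcess_antitone N hμ h) 2
  gcongr

/-- For `μ > 0`, `rowPotential N μ t` is the integral of `max 0 (√(N / s) - μ)` over `0 < s ≤ t`.
The integrand decreases in `s`, so the last unit interval contributes at least its value at `t + 1`.
The proof verifies this algebraically. -/
theorem rowPotential_succ (N : ℕ) {μ : ℝ} (hμ : 0 < μ) (t : ℕ) :
    √((N : ℝ) / (t + 1 : ℕ)) - μ ≤ rowPotential N μ (t + 1) - rowPotential N μ t := by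
  rw [Real.sqrt_div (by positivity)]
  have ht : 0 < √((t + 1 : ℕ) : ℝ) := by positivity
  rcases le_or_gt √(N : ℝ) (μ * √((t + 1 : ℕ) : ℝ)) with h | h
  · have h1 := rowPotential_mono N hμ.le (Nat.le_succ t)
    have h2 : √(N : ℝ) / √((t + 1 : ℕ) : ℝ) ≤ μ := (div_le_iff₀ ht).2 h
    simp only [Nat.succ_eq_add_one] at h1
    linarith
  · have hle : √(t : ℝ) ≤ √((t + 1 : ℕ) : ℝ) := Real.sqrt_le_sqrt (by push_cast; linarith)
    have h1 : sqrtExcess N μ (t + 1) = √N - μ * √((t + 1 : ℕ) : ℝ) := max_eq_right (by linarith)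
    have h2 : sqrtExcess N μ t = √N - μ * √(t : ℝ) := max_eq_right (by nlinarith)
    have hs := Real.sq_sqrt (show (0 : ℝ) ≤ ((t + 1 : ℕ) : ℝ) by positivity)
    have hs' := Real.sq_sqrt (show (0 : ℝ) ≤ (t : ℝ) by positivity)
    unfold rowPotential
    rw [h1, h2]
    set a := √((t + 1 : ℕ) : ℝ)
    set b := √(t : ℝ)
    set r := √(N : ℝ)
    have hab : a ^ 2 - b ^ 2 = 1 := by rw [hs, hs']; push_cast; ring
    have h4 : 1 ≤ 2 * a * (a - b) := by nlinarith [sq_nonneg (a - b)]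
    have e : (N - (r - μ * a) ^ 2) / μ - (N - (r - μ * b) ^ 2) / μ =
        (a - b) * (2 * r - μ * (a + b)) := by
      field_simp; ring
    rw [e]
    have e2 : r / a - μ = (r - μ * a) / a := by field_simp
    rw [e2, div_le_iff₀ ht]
    have h5 : 2 * (r - μ * a) ≤ 2 * r - μ * (a + b) := by nlinarith
    have h6 : 0 ≤ a - b := by linarith
    calc r - μ * a = (r - μ * a) * 1 := by ring
      _ ≤ (r - μ * a) * (2 * a * (a - b)) := by gcongr
      _ = (a - b) * (2 * (r - μ * a)) * a := by ring
      _ ≤ _ := by gcongr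

/-- Bound for the remaining cost of the depth-first search. -/
noncomputable def dfsPotential (μ : ℝ) (S : Finset (Fin n)) (stack : List (Fin n)) : ℝ :=
  ∑ u, (if u ∈ stack ∨ u ∉ S then √(len u) else 0) +
    ∑ u, rowPotential (len u) μ #(newPositions dec x u S) + μ * (n - #S)

theorem dfsPotential_nonneg {μ : ℝ} (hμ : 0 ≤ μ) (S : Finset (Fin n)) (stack : List (Fin n)) :
    0 ≤ dfsPotential dec x μ S stack := by
  have h1 : (#S : ℝ) ≤ n := by exact_mod_cast (card_le_univ S).trans_eq (Fintype.card_fin n)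
  refine add_nonneg (add_nonneg (sum_nonneg fun u _ => ?_)
    (sum_nonneg fun u _ => rowPotential_nonneg _ hμ _)) (mul_nonneg hμ (by linarith))
  split_ifs <;> positivity

theorem dfsPotential_pop (μ : ℝ) {u : Fin n} {S : Finset (Fin n)} {rest : List (Fin n)}
    (huS : u ∈ S) (hu : u ∉ rest) :
    dfsPotential dec x μ S rest + √(len u) = dfsPotential dec x μ S (u :: rest) := by
  have h : ∑ w, (if w ∈ u :: rest ∨ w ∉ S then √(len w) else 0) =
      ∑ w, (if w ∈ rest ∨ w ∉ S then √(len w) else 0) + √(len u) := by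
    rw [show √(len u : ℝ) = ∑ w, if w = u then √(len w : ℝ) else 0 by simp, ← sum_add_distrib]
    refine sum_congr rfl fun w _ => ?_
    by_cases hw : w = u
    · subst hw; simp [hu, huS]
    · simp [hw]
  unfold dfsPotential
  rw [h]; ring

/-- The new vertex enters the stack and `S` together, so its term `√(len v)` stays. The search is
paid by the drop of the potential of row `u` plus the `μ` released by visiting `v`; the other rows
can only lose potential. -/
theorem dfsPotential_push {μ : ℝ} (hμ : 0 < μ) {u v : Fin n} {S : Finset (Fin n)}
    {stack : List (Fin n)} (hv : v ∉ S) (h : (rowGraph dec x).Adj u v) :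
    dfsPotential dec x μ (insert v S) (v :: stack) + √(len u / #(newPositions dec x u S)) ≤
      dfsPotential dec x μ S stack := by
  have h1 : ∑ w, (if w ∈ v :: stack ∨ w ∉ insert v S then √(len w) else 0) =
      ∑ w, (if w ∈ stack ∨ w ∉ S then √(len w) else 0) := by
    refine sum_congr rfl fun w _ => ?_
    by_cases hw : w = v
    · subst hw; simp [hv]
    · simp [hw]
  have hlt := card_newPositions_insert_lt dec x hv h
  have h2 : ∑ w, rowPotential (len w) μ #(newPositions dec x w (insert v S)) +
      (√(len u / #(newPositions dec x u S)) - μ) ≤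
      ∑ w, rowPotential (len w) μ #(newPositions dec x w S) := by
    rw [← add_sum_erase _ _ (mem_univ u), ← add_sum_erase (a := u) univ
      (fun w => rowPotential (len w) μ #(newPositions dec x w S)) (mem_univ u)]
    have h3 : ∑ w ∈ univ.erase u, rowPotential (len w) μ #(newPositions dec x w (insert v S)) ≤
        ∑ w ∈ univ.erase u, rowPotential (len w) μ #(newPositions dec x w S) :=
      sum_le_sum fun w _ => rowPotential_mono _ hμ.le
        (card_le_card (newPositions_insert_subset dec x w v S))
    obtain ⟨t, ht⟩ : ∃ t, #(newPositions dec x u S) = t + 1 :=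
      ⟨#(newPositions dec x u S) - 1, by omega⟩
    have h4 := rowPotential_succ (len u) hμ t
    have h5 := rowPotential_mono (len u) hμ.le
      (show #(newPositions dec x u (insert v S)) ≤ t by omega)
    rw [ht]
    linarith
  have h6 : ((#(insert v S) : ℕ) : ℝ) = #S + 1 := by rw [card_insert_of_notMem hv]; push_cast; ring
  unfold dfsPotential
  rw [h1, h6]
  linarith

/-- If searching is cheap on average and reliable, then so is depth-first search. -/
theorem prob_dfsLoop_spanningTreesIn [NeZero q] {v₀ : Fin n} {Γ ε μ : ℝ} (hΓ : 0 ≤ Γ)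
    (hε : 0 ≤ ε) (hμ : 0 ≤ μ) (hμ' : ∀ u, 1 ≤ len u → 0 < μ)
    (hcost : ∀ u S, u ∈ S → (findNeighbor dec search u S).expQueries x ≤
      Γ * √(len u / (max 1 #(newPositions dec x u S) : ℕ)))
    (hfail : ∀ u S, u ∈ S → 1 ≤ #(newPositions dec x u S) → ∀ c,
      QProg.expect x (fun r _ => if r = none then 1 else 0) c
        (findNeighbor dec search u S) ≤ ε)
    (hG : (spanningTreesIn (rowGraph dec x) v₀).Nonempty) (fuel used : ℕ)
    {A : Finset (Fin n × Fin n)} {S : Finset (Fin n)} {stack : List (Fin n)}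
    (h : DfsInvariant (rowGraph dec x) v₀ A S stack)
    (hexp : ∀ u ∈ S, u ∉ stack → ∀ j, ¬ IsNewNeighbor dec x u S j)
    (hfuel : 2 * (n - #S) + stack.length ≤ fuel) :
    1 - ε * (n - #S) - (used + Γ * dfsPotential dec x μ S stack) / (B + 1) ≤
      (dfsLoop dec search B fuel used A S stack).prob x
        (spanningTreesIn (rowGraph dec x) v₀) := by
  have hcardle : ∀ S : Finset (Fin n), #S ≤ n :=
    fun S => (card_le_univ S).trans_eq (Fintype.card_fin n)
  have hcard : ∀ S : Finset (Fin n), (0 : ℝ) ≤ n - #S := fun S => by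
    have : (#S : ℝ) ≤ n := by exact_mod_cast hcardle S
    linarith
  have hB0 : (0 : ℝ) < B + 1 := by positivity
  have hnil : ∀ (A : Finset (Fin n × Fin n)) (S : Finset (Fin n)) (used : ℕ),
      DfsInvariant (rowGraph dec x) v₀ A S [] →
      (∀ u ∈ S, u ∉ [] → ∀ j, ¬ IsNewNeighbor dec x u S j) →
      1 - ε * (n - #S) - (used + Γ * dfsPotential dec x μ S []) / (B + 1) ≤
        (QProg.ret A : QProg _ q _).prob x (spanningTreesIn (rowGraph dec x) v₀) := by
    intro A S used h hexp
    have hA := mem_spanningTreesIn dec x h (fun u hu => hexp u hu (by simp)) hG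
    simp only [QProg.prob, Set.indicator_of_mem hA, Pi.one_apply]
    have h1 := mul_nonneg hε (hcard S)
    have h2 : 0 ≤ (used + Γ * dfsPotential dec x μ S []) / (B + 1) := by
      have := dfsPotential_nonneg dec x hμ S []
      positivity
    linarith
  induction fuel generalizing used A S stack with
  | zero =>
    obtain rfl : stack = [] := List.length_eq_zero_iff.1 (by omega)
    exact hnil A S used h hexp
  | succ fuel ih =>
    cases stack with
    | nil => exact hnil A S used h hexp
    | cons u rest =>
      have huS : u ∈ S := h.subset u List.mem_cons_self
      have hurest : u ∉ rest := (List.nodup_cons.1 h.nodup).1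
      rw [dfsLoop]
      split_ifs with hB
      -- Past the cutoff `used ≥ B + 1`, so the claimed lower bound is not positive.
      · have h1 := mul_nonneg hε (hcard S)
        have h2 : 1 ≤ (used + Γ * dfsPotential dec x μ S (u :: rest)) / (B + 1) := by
          rw [one_le_div hB0]
          have h3 : (B : ℝ) + 1 ≤ used := by exact_mod_cast hB
          have h4 := mul_nonneg hΓ (dfsPotential_nonneg dec x hμ S (u :: rest))
          linarith
        have h3 := QProg.prob_nonneg x (spanningTreesIn (rowGraph dec x) v₀)
          (QProg.ret A : QProg ((u : Fin n) × Fin (len u)) q _)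
        linarith
      · rw [QProg.prob_counted_bind]
        have hlin : ∀ X : ℝ, QProg.expect x (fun _ c => X + -(1 / (B + 1)) * (c : ℝ)) used
            (findNeighbor dec search u S) = X - (used +
              (findNeighbor dec search u S).expQueries x) / (B + 1) := by
          intro X
          rw [QProg.expect_add x (fun _ _ => X), QProg.expect_const, QProg.expect_const_mul,
            QProg.expect_queries]
          ring
        have hc := hcost u S huS
        rcases Nat.eq_zero_or_pos #(newPositions dec x u S) with ht | ht
        · rw [ht, max_eq_left (by omega), Nat.cast_one, div_one] at hc
          -- No new neighbor exists, so the search surely returns `none`; its cost is paid by the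
          -- term `√(len u)` released when `u` is popped.
          have hpot := dfsPotential_pop dec x μ huS hurest
          refine le_trans ?_ (QProg.expect_mono (surely_findNeighbor dec x search u S)
            (h := fun _ c => (1 - ε * (n - #S) - Γ * dfsPotential dec x μ S rest / (B + 1)) +
              -(1 / (B + 1)) * (c : ℝ)) (fun r c hr => ?_) used)
          · rw [hlin, ← hpot]
            have h1 : (used + (findNeighbor dec search u S).expQueries x) / (B + 1) ≤
                (used + Γ * √(len u)) / ((B : ℝ) + 1) := by gcongr
            have h2 : (used + Γ * (dfsPotential dec x μ S rest + √(len u))) / ((B : ℝ) + 1) =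
                Γ * dfsPotential dec x μ S rest / (B + 1) +
                  (used + Γ * √(len u)) / ((B : ℝ) + 1) := by rw [← add_div]; ring
            linarith
          · cases r with
            | none =>
              refine le_trans (le_of_eq ?_) (ih c h.pop (fun w hw hwr j hj => ?_) ?_)
              · ring
              · by_cases hwu : w = u
                · subst hwu
                  have := card_pos.2 ⟨j, (mem_newPositions dec x).2 hj⟩
                  omega
                · exact hexp w hw (by simp [hwu, hwr]) j hj
              · simp only [List.length_cons] at hfuel
                omega
            | some v =>
              have := newPositions_nonempty dec x (hr v rfl).1 (hr v rfl).2
              omega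
        · rw [max_eq_right ht] at hc
          have hμ0 : 0 < μ := hμ' u (le_trans ht (card_newPositions_le dec x u S))
          have hf := hfail u S huS ht used
          set t := #(newPositions dec x u S) with htdef
          set P := dfsPotential dec x μ S (u :: rest) with hP
          have hP0 : 0 ≤ P - √(len u / t) := by
            obtain ⟨j, hj⟩ := card_pos.1 ht
            obtain ⟨v, hjv, hv⟩ := (mem_newPositions dec x).1 hj
            have h1 := dfsPotential_push dec x hμ0 (stack := u :: rest) hv
              (show (rowGraph dec x).Adj u v from ⟨j, hjv⟩)
            have h2 := dfsPotential_nonneg dec x hμ (insert v S) (v :: u :: rest)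
            linarith
          have hSn : #S + 1 ≤ n := by
            obtain ⟨j, hj⟩ := card_pos.1 ht
            obtain ⟨v, hjv, hv⟩ := (mem_newPositions dec x).1 hj
            rw [← card_insert_of_notMem hv]
            exact hcardle _
          have hSn' : (#S : ℝ) + 1 ≤ n := by exact_mod_cast hSn
          -- `X - c / (B + 1)` is the bound guaranteed after a discovery with counter `c`. A miss is
          -- charged `1`, and as `X ≤ 1` the bound for it is not positive, so `hexp` need not
          -- survive a miss.
          set X : ℝ := 1 - ε * (n - #S - 1) - Γ * (P - √(len u / t)) / (B + 1) with hX
          have hX1 : X ≤ 1 := by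
            have h1 : 0 ≤ ε * (n - #S - 1) := mul_nonneg hε (by linarith)
            have h2 : 0 ≤ Γ * (P - √(len u / t)) / (B + 1) := by positivity
            linarith
          refine le_trans ?_ (QProg.expect_mono (surely_findNeighbor dec x search u S)
            (h := fun r c => (X + -(1 / (B + 1)) * (c : ℝ)) +
              -1 * (if r = none then (1 : ℝ) else 0)) (fun r c hr => ?_) used)
          · rw [QProg.expect_add x (fun _ c => X + -(1 / (B + 1)) * (c : ℝ)), hlin,
              QProg.expect_const_mul]
            have h1 : (used + (findNeighbor dec search u S).expQueries x) / (B + 1) ≤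
                (used + Γ * √(len u / t)) / ((B : ℝ) + 1) := by gcongr
            have h2 : (used + Γ * P) / ((B : ℝ) + 1) = Γ * (P - √(len u / t)) / (B + 1) +
                (used + Γ * √(len u / t)) / ((B : ℝ) + 1) := by rw [← add_div]; ring
            rw [h2, hX]
            linarith
          · cases r with
            | none =>
              refine le_trans ?_ (QProg.prob_nonneg _ _ _)
              have : 0 ≤ 1 / ((B : ℝ) + 1) * c := by positivity
              simp only [if_true]
              linarith
            | some v =>
              obtain ⟨hv, huv⟩ := hr v rfl
              have h1 := dfsPotential_push dec x hμ0 (stack := u :: rest) hv huv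
              refine le_trans ?_ (ih c (h.push hv huv) (fun w hw hwr j hj => ?_) ?_)
              · rw [card_insert_of_notMem hv, hX]
                have h2 : Γ * dfsPotential dec x μ (insert v S) (v :: u :: rest) / (B + 1) ≤
                    Γ * (P - √(len u / t)) / (B + 1) := by
                  gcongr
                  linarith
                have h3 : (c + Γ * dfsPotential dec x μ (insert v S) (v :: u :: rest)) / (B + 1) =
                    1 / ((B : ℝ) + 1) * c +
                      Γ * dfsPotential dec x μ (insert v S) (v :: u :: rest) / (B + 1) := by
                  ring
                rw [h3]
                push_cast
                linarith
              · obtain ⟨y, hy, hyS⟩ := hj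
                rcases mem_insert.1 hw with rfl | hw
                · simp at hwr
                · refine hexp w hw (fun hmem => hwr (List.mem_cons_of_mem v hmem)) j
                    ⟨y, hy, fun hmem => hyS (mem_insert_of_mem hmem)⟩
              · rw [card_insert_of_notMem hv]
                simp only [List.length_cons] at hfuel ⊢
                omega

end Loop

/-! ### Constants and the resulting bounds -/

section Main

open Finset

variable {n q : ℕ} {len : Fin n → ℕ}

/-- Cutoff for the depth-first search. -/
noncomputable def dfsCutoff (n : ℕ) (len : Fin n → ℕ) : ℕ :=
  ⌊169440 * √(n * (∑ u, len u : ℕ) * Real.log n)⌋₊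

theorem maxQueries_dfs_groverSearch [NeZero q]
    (dec : (u : Fin n) → Fin (len u) → Fin q → Option (Fin n))
    (v₀ : Fin n) :
    ((dfs dec (groverSearch dec) (dfsCutoff n len) v₀).maxQueries : ℝ) ≤
      169640 * √(n * (∑ u, len u : ℕ) * Real.log n) := by
  set σ := √(n * (∑ u, len u : ℕ) * Real.log n) with hσ
  have hR : ∀ u S, (findNeighbor dec (groverSearch dec) u S).maxQueries ≤ ⌊200 * σ⌋₊ := by
    intro u S
    apply Nat.le_floor
    refine (maxQueries_findNeighbor_groverSearch dec u S).trans ?_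
    rw [hσ]
    have h1 : len u ≤ n * ∑ u, len u :=
      (single_le_sum (f := len) (fun _ _ => Nat.zero_le _) (mem_univ u)).trans
        (Nat.le_mul_of_pos_left _ (Fin.pos u))
    have h2 : (len u : ℝ) ≤ n * (∑ u, len u : ℕ) := by exact_mod_cast h1
    have h3 : 0 ≤ Real.log n := Real.log_natCast_nonneg n
    gcongr
  have h := maxQueries_dfsLoop dec (groverSearch dec) (dfsCutoff n len) hR (2 * n) 0 ∅ {v₀} [v₀]
    (Nat.zero_le _)
  have h' : ((dfs dec (groverSearch dec) (dfsCutoff n len) v₀).maxQueries : ℝ) ≤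
      dfsCutoff n len + ⌊200 * σ⌋₊ := by
    rw [zero_add] at h
    exact_mod_cast h
  have h1 := Nat.floor_le (show 0 ≤ 169440 * σ by positivity)
  have h2 := Nat.floor_le (show 0 ≤ 200 * σ by positivity)
  unfold dfsCutoff at h' ⊢
  linarith

/-- Each of the three sums is at most `√(n * m)`: the first by Cauchy–Schwarz, the others because `m
/ μ` and `μ * n` both equal `√(n * m)` for `μ = √(m / n)`. If `m = 0` then `μ = 0`, and division by
zero gives `0`. -/
theorem dfsPotential_init_le (dec : (u : Fin n) → Fin (len u) → Fin q → Option (Fin n))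
    (x : (u : Fin n) × Fin (len u) → Fin q) (v₀ : Fin n) :
    dfsPotential dec x √((∑ u, len u : ℕ) / n) {v₀} [v₀] ≤ 3 * √(n * (∑ u, len u : ℕ)) := by
  have hn : (0 : ℝ) < n := by exact_mod_cast Fin.pos v₀
  set m : ℝ := ((∑ u, len u : ℕ) : ℝ) with hm
  have hm0 : 0 ≤ m := by positivity
  have hm' : m = ∑ u, (len u : ℝ) := by rw [hm]; push_cast; rfl
  have hsn : √(n : ℝ) * √(n : ℝ) = n := Real.mul_self_sqrt hn.le
  have hsm : √m * √m = m := Real.mul_self_sqrt hm0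
  have hsn0 : 0 < √(n : ℝ) := Real.sqrt_pos.2 hn
  have h1 : ∑ u, (if u ∈ [v₀] ∨ u ∉ ({v₀} : Finset (Fin n)) then √(len u) else 0) ≤ √(n * m) := by
    have : ∀ u, (if u ∈ [v₀] ∨ u ∉ ({v₀} : Finset (Fin n)) then √(len u : ℝ) else 0) =
        √(len u) := by
      intro u
      rw [if_pos]
      simp [em]
    simp only [this]
    apply Real.le_sqrt_of_sq_le
    have h := sq_sum_le_card_mul_sum_sq (s := (univ : Finset (Fin n)))
      (f := fun u => √(len u : ℝ))
    rw [card_univ, Fintype.card_fin] at h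
    refine h.trans (le_of_eq ?_)
    rw [hm']
    congr 1
    exact sum_congr rfl fun u _ => Real.sq_sqrt (by positivity)
  have h2 : ∑ u, rowPotential (len u) √(m / n) #(newPositions dec x u {v₀}) ≤ √(n * m) := by
    calc _ ≤ ∑ u, (len u : ℝ) / √(m / n) :=
          sum_le_sum fun u _ => rowPotential_le _ (Real.sqrt_nonneg _) _
      _ = m / √(m / n) := by rw [← sum_div, hm']
      _ = √(n * m) := by
        rw [Real.sqrt_div hm0, Real.sqrt_mul hn.le]
        nth_rewrite 1 [← hsm]
        rcases eq_or_ne (√m) 0 with h | h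
        · simp [h]
        · field_simp
  have h3 : √(m / n) * (n - (#({v₀} : Finset (Fin n)) : ℕ)) ≤ √(n * m) := by
    calc √(m / n) * (n - (#({v₀} : Finset (Fin n)) : ℕ)) ≤ √(m / n) * n := by
          gcongr
          simp
      _ = √(n * m) := by
        rw [Real.sqrt_div hm0, Real.sqrt_mul hn.le]
        nth_rewrite 2 [← hsn]
        field_simp
  unfold dfsPotential
  linarith

theorem prob_dfs_groverSearch [NeZero q]
    (dec : (u : Fin n) → Fin (len u) → Fin q → Option (Fin n))
    (x : (u : Fin n) × Fin (len u) → Fin q) (v₀ : Fin n) (hlen : ∀ u, len u ≤ n)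
    (hG : (spanningTreesIn (rowGraph dec x) v₀).Nonempty) :
    9 / 10 ≤ (dfs dec (groverSearch dec) (dfsCutoff n len) v₀).prob x
      (spanningTreesIn (rowGraph dec x) v₀) := by
  have hn : (0 : ℝ) < n := by exact_mod_cast Fin.pos v₀
  have h := prob_dfsLoop_spanningTreesIn dec x (groverSearch dec) (dfsCutoff n len)
    (Γ := 2824 * √(Real.log n)) (ε := 1 / (20 * (n : ℝ))) (μ := √((∑ u, len u : ℕ) / n))
    (by positivity) (by positivity) (Real.sqrt_nonneg _)
    -- A nonempty row makes `m`, and with it `μ`, positive.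
    (fun u hu => by
      have : 1 ≤ ∑ u, len u := hu.trans
        (single_le_sum (f := len) (fun _ _ => Nat.zero_le _) (mem_univ u))
      positivity)
    (fun u S hu => expQueries_findNeighbor_groverSearch dec x (hlen u) hu)
    (fun u S hu ht c => expect_none_findNeighbor dec x (hlen u) hu ht c) hG (2 * n) 0
    (dfsInvariant_init (rowGraph dec x) v₀)
    (fun u hu hu' => by simp at hu hu'; exact absurd hu hu')
    (by have := Fin.pos v₀
        simp only [card_singleton, List.length_singleton]
        omega)
  refine le_trans ?_ h
  have h1 : 1 / (20 * (n : ℝ)) * (n - (#({v₀} : Finset (Fin n)) : ℕ)) ≤ 1 / 20 := by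
    rw [div_mul_eq_mul_div, one_mul, div_le_div_iff₀ (by positivity) (by norm_num),
      card_singleton]
    push_cast
    linarith
  -- Markov's inequality: the cutoff is 20 times the bound on the expected cost, `169440 = 20 * 2824
  -- * 3`.
  have h2 : (((0 : ℕ) : ℝ) + 2824 * √(Real.log n) *
      dfsPotential dec x √((∑ u, len u : ℕ) / n) {v₀} [v₀]) / (dfsCutoff n len + 1) ≤ 1 / 20 := by
    rw [div_le_div_iff₀ (by positivity) (by norm_num), Nat.cast_zero, zero_add, one_mul]
    have h3 := mul_le_mul_of_nonneg_left (dfsPotential_init_le dec x v₀)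
      (show 0 ≤ 2824 * √(Real.log n) by positivity)
    have h4 := Nat.lt_floor_add_one (169440 * √(n * (∑ u, len u : ℕ) * Real.log n))
    rw [Real.sqrt_mul (by positivity)] at h4
    have h5 : ((dfsCutoff n len : ℕ) : ℝ) =
      ⌊169440 * (√((n : ℝ) * (∑ u, len u : ℕ)) * √(Real.log n))⌋₊ := by
      rw [← Real.sqrt_mul (by positivity)]; rfl
    rw [h5]
    linarith
  linarith

end Main

theorem mainTheorem10 :
    -- the adjacency array model, with out-degrees `d` and `m = ∑ u, d u` edges
    (∃ C : ℝ, ∀ (n : ℕ) (d : Fin n → ℕ) (v₀ : Fin n),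
      ∃ (search : SearchFamily n n d) (B : ℕ),
        IsNeighborSearch (arrayDec d)
          {x | ∀ u, Function.Injective fun j : Fin (d u) => x ⟨u, j⟩} C search ∧
        ((dfs (arrayDec d) search B v₀).maxQueries : ℝ) ≤
          C * Real.sqrt (n * (∑ u, d u : ℕ) * Real.log n) ∧
        ∀ f : (u : Fin n) → Fin (d u) → Fin n, (∀ u, Function.Injective (f u)) →
          (dfs (arrayDec d) search B v₀).prob (fun p => f p.1 p.2)
            (treesIn (arrayGraph f) v₀) = 1 ∧
          ((spanningTreesIn (arrayGraph f) v₀).Nonempty →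
            9 / 10 ≤ (dfs (arrayDec d) search B v₀).prob (fun p => f p.1 p.2)
              (spanningTreesIn (arrayGraph f) v₀))) ∧
    -- the adjacency matrix model, with `m = n * (n - 1)`
    (∃ C : ℝ, ∀ (n : ℕ) (v₀ : Fin n),
      ∃ (search : SearchFamily n 2 fun _ => n) (B : ℕ),
        IsNeighborSearch matrixDec Set.univ C search ∧
        ((dfs matrixDec search B v₀).maxQueries : ℝ) ≤
          C * Real.sqrt (n * (n * ((n : ℝ) - 1)) * Real.log n) ∧
        ∀ M : Fin n → Fin n → Fin 2,
          (dfs matrixDec search B v₀).prob (fun p => M p.1 p.2)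
            (treesIn (matrixGraph M) v₀) = 1 ∧
          ((spanningTreesIn (matrixGraph M) v₀).Nonempty →
            9 / 10 ≤ (dfs matrixDec search B v₀).prob (fun p => M p.1 p.2)
              (spanningTreesIn (matrixGraph M) v₀))) := by
  constructor
  · refine ⟨169640, fun n d v₀ => ?_⟩
    have : NeZero n := ⟨(Fin.pos v₀).ne'⟩
    refine ⟨groverSearch (arrayDec d), dfsCutoff n d,
      isNeighborSearch_groverSearch _ _ (by norm_num) fun x hx u => ?_,
      maxQueries_dfs_groverSearch _ v₀, fun f hf => ?_⟩
    · simpa using Fintype.card_le_of_injective _ (hx u)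
    · have hgraph : arrayGraph f = rowGraph (arrayDec d) fun p => f p.1 p.2 := by
        ext u v
        simp [arrayGraph, rowGraph, arrayDec]
      rw [hgraph]
      exact ⟨prob_dfsLoop_treesIn _ _ _ _ _ _ (dfsInvariant_init _ v₀),
        prob_dfs_groverSearch _ _ v₀ fun u => by
          simpa using Fintype.card_le_of_injective _ (hf u)⟩
  · refine ⟨339280, fun n v₀ => ⟨groverSearch matrixDec, dfsCutoff n fun _ => n,
      isNeighborSearch_groverSearch _ _ (by norm_num) fun _ _ _ => le_rfl,
      (maxQueries_dfs_groverSearch _ v₀).trans ?_, fun M => ?_⟩⟩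
    -- The rows have `n * n` entries in total, and `n * n ≤ 4 * (n * (n - 1))` for `n ≥ 2`, which
    -- doubles the constant; for `n = 1` both sides vanish with `log n`.
    · rw [show (339280 : ℝ) = 169640 * √4 by
        rw [show (4 : ℝ) = 2 ^ 2 by norm_num]; simp; norm_num, mul_assoc (169640 : ℝ) √4,
        ← Real.sqrt_mul (by norm_num)]
      refine mul_le_mul_of_nonneg_left (Real.sqrt_le_sqrt ?_) (by norm_num)
      simp only [Finset.sum_const, Finset.card_univ, Fintype.card_fin, smul_eq_mul, Nat.cast_mul]
      rcases Nat.lt_or_ge n 2 with hn | hn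
      · have : Real.log n = 0 := by interval_cases n <;> simp
        simp [this]
      · have hn' : (2 : ℝ) ≤ n := by exact_mod_cast hn
        have hlog : 0 ≤ Real.log n := Real.log_natCast_nonneg n
        have h : (n : ℝ) * (n * n) ≤ 4 * (n * (n * (n - 1))) := by
          have : (n : ℝ) ≤ 4 * (n - 1) := by linarith
          calc (n : ℝ) * (n * n) ≤ n * (n * (4 * (n - 1))) := by gcongr
            _ = _ := by ring
        calc (n : ℝ) * (n * n) * Real.log n ≤ 4 * (n * (n * (n - 1))) * Real.log n := by gcongr
          _ = _ := by ring
    · have hgraph : matrixGraph M = rowGraph matrixDec fun p => M p.1 p.2 := by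
        ext u v
        simp [matrixGraph, rowGraph, matrixDec]
      rw [hgraph]
      exact ⟨prob_dfsLoop_treesIn _ _ _ _ _ _ (dfsInvariant_init _ v₀),
        prob_dfs_groverSearch _ _ v₀ fun _ => le_rfl⟩
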